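/- **Theorem 5.1.** For integers $n\ge 1$ let $$a_n=\frac{(2n)!!}{2^n(2n-1)!!},\qquad I_n(\theta)=a_n(1+\cos\theta)^n,\qquad S(\theta)=-\sin\theta ,$$ $$\alpha_n^{*}:=\Big(\frac{\pi}{2^{n+1}a_n}\,\frac{n}{n+1}-\frac1{2^n}\Big)\frac{1}{\sqrt{2n-1}}\Big(\frac{2n}{2n-1}\Big)^{n-1}.$$ As $n\to\infty$, $\alpha_n^{*}$ is exactly of order $1/n$, and for each fixed $\nu>0$ the quantity $\nu/(2^{n+1}a_n)$ is exactly of order $\nu/\sqrt n$ (two-sided bounds up to positive constants for all large $n$). Let $n\ge 2$, $N\ge 1$, $\nu>0$, and let $\Theta(t)=(\theta_1(t),\dots,\theta_N(t))$, $t\ge 0$, be a global solution of the Winfree model of order $n$ with identical natural frequencies $\nu_i=\nu$, $$\dot\theta_i=\nu+\frac{\kappa}{N}\sum_{j=1}^N I_n(\theta_j)\,S(\theta_i),\qquad i=1,\dots,N .$$ Put $R(t)=\tfrac12\big(\max_i\theta_i(t)-\min_i\theta_i(t)\big)$ and suppose that $$0<\kappa<\frac{\nu}{2^{n+1}a_n},\qquad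 0<\alpha<\alpha_n^{*},\qquad R(0)<\alpha\exp\Big[-\alpha\sqrt{2n-1}\Big(\frac{2n-1}{2n}\Big)^{n-1}-\frac{1}{2^{n-1}}\Big].$$ Then there exist positive constants $\tilde\beta_1,\tilde\beta_2,\tilde\Lambda_1,\tilde\Lambda_2$ such that $$\tilde\beta_1e^{-\tilde\Lambda_1t}R(0)\le R(t)\le\tilde\beta_2e^{-\tilde\Lambda_2t}R(0)<\alpha\qquad\text{for all }t\ge0 .$$ Moreover the ensemble exhibits locking: there is a constant $\rho\ne0$ such that $\lim_{t\to\infty}\theta_i(t)/t=\rho$ for every $i$, and $|\rho-\nu|\le\kappa\,2^na_n$. -/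

import Mathlib

open Real Set Filter Topology Asymptotics
open scoped Nat

namespace Winfree

noncomputable section

/-- The normalizing coefficient `a_n = (2n)!! / (2^n (2n-1)!!)`, for `n ≥ 1`. -/
def coeff (n : ℕ) : ℝ := ((2 * n)‼ : ℝ) / (2 ^ n * ((2 * n - 1)‼ : ℝ))

/-- The influence function `I_n(x) = a_n (1 + cos x)^n` of order `n`. -/
def influence (n : ℕ) (x : ℝ) : ℝ := coeff n * (1 + Real.cos x) ^ n

/-- The sensitivity function `S(x) = - sin x`. -/
def sensitivity (x : ℝ) : ℝ := -Real.sin x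

/-- `θ` is a global (forward in time) solution of the Winfree model of order `n` with `N`
oscillators, natural frequencies `freq i` and coupling strength `κ`; at `t = 0` the derivative is
one-sided. -/
def IsGlobalSolution {N : ℕ} (n : ℕ) (κ : ℝ) (freq : Fin N → ℝ) (θ : Fin N → ℝ → ℝ) : Prop :=
  ∀ i : Fin N, ∀ t : ℝ, 0 ≤ t →
    HasDerivWithinAt (θ i)
      (freq i + κ / (N : ℝ) * ∑ j : Fin N, influence n (θ j t) * sensitivity (θ i t))
      (Set.Ici 0) t

/-- The half-diameter `R(t) = (max_i θ_i(t) - min_i θ_i(t)) / 2`. The supremum and infimum run over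
the finite index set, so for `0 < N` they are the maximum and the minimum. -/
def halfDiameter {N : ℕ} (θ : Fin N → ℝ → ℝ) (t : ℝ) : ℝ :=
  ((⨆ i : Fin N, θ i t) - (⨅ i : Fin N, θ i t)) / 2

/-- `ρ` is the rotation number `lim_{t → ∞} x(t) / t` of the phase `x`. -/
def HasRotationNumber (x : ℝ → ℝ) (ρ : ℝ) : Prop :=
  Tendsto (fun t : ℝ => x t / t) atTop (𝓝 ρ)

/-- The ensemble exhibits locking with common rotation number `ρ`: all rotation numbers exist and
equal the nonzero constant `ρ`. -/
def ExhibitsLocking {N : ℕ} (θ : Fin N → ℝ → ℝ) (ρ : ℝ) : Prop :=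
  ρ ≠ 0 ∧ ∀ i : Fin N, HasRotationNumber (θ i) ρ

/-- The upper bound `ν / (2^{n+1} a_n)` for the coupling strength. -/
def couplingThreshold (n : ℕ) (ν : ℝ) : ℝ := ν / (2 ^ (n + 1) * coeff n)

/-- The upper bound for `α`:
`(π / (2^{n+1} a_n) * n / (n+1) - 1 / 2^n) * (1 / √(2n-1)) * (2n / (2n-1))^{n-1}`. -/
def alphaThreshold (n : ℕ) : ℝ :=
  (π / (2 ^ (n + 1) * coeff n) * ((n : ℝ) / ((n : ℝ) + 1)) - 1 / 2 ^ n) *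
    (1 / √(2 * (n : ℝ) - 1)) * (2 * (n : ℝ) / (2 * (n : ℝ) - 1)) ^ (n - 1)

/-- The upper bound for the initial half-diameter:
`α * exp (- α √(2n-1) ((2n-1)/(2n))^{n-1} - 1 / 2^{n-1})`. -/
def initialBound (n : ℕ) (α : ℝ) : ℝ :=
  α * Real.exp (-(α * √(2 * (n : ℝ) - 1) * ((2 * (n : ℝ) - 1) / (2 * (n : ℝ))) ^ (n - 1))
    - 1 / 2 ^ (n - 1))

end

end Winfree

/-! ### Size of the coefficients and of the two thresholds -/

namespace Winfree

/-! Since all frequencies agree, phases keep their initial order, so the largest and smallest phases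
belong to two fixed oscillators. Their midpoint `m` and half-gap `r` satisfy `m' = ν - κ I cos r sin
m` and `r' = -κ I cos m sin r`, where `I` is the mean influence. The bound on `κ` says `κ I ≤ ν /
2`, hence `ν / 2 ≤ m' ≤ 3 ν / 2`: the midpoint keeps turning and can serve as the clock.

While `r ≤ α`, the mean `I` differs from `I_n(m)` by at most `δ = L α`, where `L` is the maximal
slope of `I_n`. In the clock `m`, the logarithmic derivative of `r` is then at most `κ / ν` times a
`2π`-periodic function of `m` (`neg_mul_cos_mul_sin_le`). Contraction where `cos m > 0` outweighs
expansion where `cos m < 0`, because `I_n` has its mass near `0` and is at most `a_n` on the bad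
half: the integral over a turn is at most `3/2 a_n + 7/2 δ - π n/(n+1)`
(`integral_growthRate_sub_decayRate_le`), which the bound on `α` makes negative.

So `r` shrinks by a fixed factor per turn, up to a bounded factor `β` for the incomplete turn
(`exists_rate`). The initial bound is `α / β`, which closes the continuity argument for `r < α`
(`halfGap_lt`). The lower bound on `r` follows from `|r'| ≤ κ 2^n a_n r`.

For locking, `r → 0` exponentially makes each phase follow the scalar periodic equation `θ' = ν - κ
I_n(θ) sin θ` up to an integrable error. Straightening that flow gives the rotation number
(`exists_hasRotationNumber`). -/

lemma coeff_succ (n : ℕ) : coeff (n + 1) = coeff n * ((n + 1) / (2 * n + 1)) := by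
  have h2 : ((2 * n + 1 : ℕ)‼ : ℝ) = (2 * n + 1) * ((2 * n - 1 : ℕ)‼ : ℝ) := by
    rcases n with _ | n
    · simp
    · have : 2 * (n + 1) + 1 = (2 * n + 1) + 2 := by ring
      rw [this, Nat.doubleFactorial_add_two]
      have : 2 * (n + 1) - 1 = 2 * n + 1 := by omega
      rw [this]
      push_cast
      ring
  have h3 : 2 * (n + 1) - 1 = 2 * n + 1 := by omega
  have h4 : 2 * (n + 1) = 2 * n + 2 := by ring
  have h5 : (0 : ℝ) < ((2 * n - 1 : ℕ)‼ : ℝ) := by exact_mod_cast Nat.doubleFactorial_pos _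
  have h6 : (0 : ℝ) < 2 * n + 1 := by positivity
  unfold coeff
  rw [h3, h2, h4, Nat.doubleFactorial_add_two]
  push_cast
  field_simp
  ring

lemma coeff_zero : coeff 0 = 1 := by simp [coeff]

lemma coeff_pos (n : ℕ) : 0 < coeff n := by
  induction n with
  | zero => simp [coeff_zero]
  | succ n ih => rw [coeff_succ]; positivity

/-- The maximum `2^n a_n` of the influence function. -/
noncomputable def peak (n : ℕ) : ℝ := 2 ^ n * coeff n

lemma peak_pos (n : ℕ) : 0 < peak n := mul_pos (by positivity) (coeff_pos n)

lemma peak_succ (n : ℕ) : peak (n + 1) = peak n * ((2 * n + 2) / (2 * n + 1)) := by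
  unfold peak
  rw [coeff_succ, pow_succ]
  ring

/-- Wallis-type bounds by induction: `peak n` is `(2n)!! / (2n-1)!!`, so it has order `√n`. -/
lemma le_peak_sq (n : ℕ) : (2 * n + 1 : ℝ) ≤ peak n ^ 2 := by
  induction n with
  | zero => simp [peak, coeff_zero]
  | succ n ih =>
    rw [peak_succ, mul_pow]
    calc (2 * ((n + 1 : ℕ) : ℝ) + 1) ≤ (2 * n + 1) * ((2 * n + 2) / (2 * n + 1)) ^ 2 := by
          rw [div_pow, ← mul_div_assoc, le_div_iff₀ (by positivity)]
          push_cast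
          have : (0 : ℝ) ≤ n := n.cast_nonneg
          nlinarith
      _ ≤ _ := by gcongr

lemma peak_sq_le {n : ℕ} (hn : 1 ≤ n) : peak n ^ 2 ≤ 4 * n := by
  induction n, hn using Nat.le_induction with
  | base =>
    rw [peak_succ]
    norm_num [peak, coeff_zero]
  | succ n hn ih =>
    rw [peak_succ, mul_pow]
    calc peak n ^ 2 * ((2 * n + 2) / (2 * n + 1)) ^ 2
        ≤ 4 * n * ((2 * n + 2) / (2 * n + 1)) ^ 2 := by gcongr
      _ ≤ 4 * ((n + 1 : ℕ) : ℝ) := by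
          rw [div_pow, ← mul_div_assoc, div_le_iff₀ (by positivity)]
          push_cast
          have : (0 : ℝ) ≤ n := n.cast_nonneg
          nlinarith

lemma sqrt_le_peak (n : ℕ) : √n ≤ peak n := by
  rw [Real.sqrt_le_left (peak_pos n).le]
  have : (0 : ℝ) ≤ n := n.cast_nonneg
  linarith [le_peak_sq n]

lemma peak_le_sqrt {n : ℕ} (hn : 1 ≤ n) : peak n ≤ 2 * √n := by
  refine (abs_le_of_sq_le_sq' ?_ (by positivity)).2
  rw [mul_pow, Real.sq_sqrt (by positivity)]
  linarith [peak_sq_le hn]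

lemma couplingThreshold_eq (n : ℕ) (ν : ℝ) : couplingThreshold n ν = ν / (2 * peak n) := by
  unfold couplingThreshold peak
  ring_nf

/-- The factor `√(2n-1) ((2n-1)/(2n))^(n-1)` of the maximal slope of the influence function. -/
noncomputable def slope (n : ℕ) : ℝ :=
  √(2 * (n : ℝ) - 1) * ((2 * (n : ℝ) - 1) / (2 * (n : ℝ))) ^ (n - 1)

lemma slope_le {n : ℕ} (hn : 1 ≤ n) : slope n ≤ √(2 * (n : ℝ) - 1) := by
  have hn' : (1 : ℝ) ≤ n := by exact_mod_cast hn
  refine mul_le_of_le_one_right (Real.sqrt_nonneg _) (pow_le_one₀ ?_ ?_)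
  · exact div_nonneg (by linarith) (by linarith)
  · rw [div_le_one (by linarith)]
    linarith

/-- Bernoulli's inequality keeps `(1 - 1/(2n))^(n-1)` above `1/2`. -/
lemma le_slope {n : ℕ} (hn : 1 ≤ n) : √(2 * (n : ℝ) - 1) / 2 ≤ slope n := by
  have hn' : (1 : ℝ) ≤ n := by exact_mod_cast hn
  unfold slope
  rw [div_eq_mul_inv]
  refine mul_le_mul_of_nonneg_left ?_ (Real.sqrt_nonneg _)
  have h := one_add_mul_le_pow (a := -(1 / (2 * (n : ℝ)))) (by
    have : 1 / (2 * (n : ℝ)) ≤ 1 := by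
      rw [div_le_one (by linarith)]; linarith
    linarith) (n - 1)
  have e : (2 * (n : ℝ) - 1) / (2 * (n : ℝ)) = 1 + -(1 / (2 * (n : ℝ))) := by
    field_simp
    ring
  rw [e]
  refine le_trans ?_ h
  rw [Nat.cast_sub hn]
  have : 1 + ((n : ℝ) - (1 : ℕ)) * -(1 / (2 * (n : ℝ))) = 1 / 2 + 1 / (2 * (n : ℝ)) := by
    push_cast
    field_simp
    ring
  rw [this]
  have : 0 ≤ 1 / (2 * (n : ℝ)) := by positivity
  norm_num

lemma slope_pos {n : ℕ} (hn : 1 ≤ n) : 0 < slope n := by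
  have hn' : (1 : ℝ) ≤ n := by exact_mod_cast hn
  refine lt_of_lt_of_le ?_ (le_slope hn)
  have : 0 < √(2 * (n : ℝ) - 1) := Real.sqrt_pos.2 (by linarith)
  linarith

lemma alphaThreshold_eq {n : ℕ} (hn : 1 ≤ n) : alphaThreshold n =
    (π / (2 * peak n) * ((n : ℝ) / ((n : ℝ) + 1)) - 1 / 2 ^ n) / slope n := by
  have hn' : (1 : ℝ) ≤ n := by exact_mod_cast hn
  have h : 0 < 2 * (n : ℝ) - 1 := by linarith
  have h1 : 0 < √(2 * (n : ℝ) - 1) := Real.sqrt_pos.2 h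
  have e : (2 : ℝ) ^ (n + 1) * coeff n = 2 * peak n := by unfold peak; ring
  unfold alphaThreshold slope
  rw [e, mul_assoc, div_eq_mul_inv _ (√(2 * (n : ℝ) - 1) * _), mul_inv, ← inv_pow, inv_div,
    one_div √(2 * (n : ℝ) - 1)]

lemma four_mul_le_two_pow {n : ℕ} (hn : 4 ≤ n) : 4 * n ≤ 2 ^ n := by
  induction n, hn using Nat.le_induction with
  | base => norm_num
  | succ n hn ih => rw [pow_succ]; omega

lemma couplingThreshold_isTheta {ν : ℝ} (hν : 0 < ν) :
    (fun n : ℕ => couplingThreshold n ν) =Θ[atTop] (fun n : ℕ => ν / √(n : ℝ)) := by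
  constructor
  · refine IsBigO.of_bound 1 ?_
    filter_upwards [eventually_ge_atTop 1] with n hn
    have hs : 0 < √(n : ℝ) := Real.sqrt_pos.2 (by exact_mod_cast hn)
    have hp := peak_pos n
    rw [couplingThreshold_eq, Real.norm_of_nonneg (by positivity),
      Real.norm_of_nonneg (by positivity), one_mul]
    gcongr
    linarith [sqrt_le_peak n]
  · refine IsBigO.of_bound 4 ?_
    filter_upwards [eventually_ge_atTop 1] with n hn
    have hs : 0 < √(n : ℝ) := Real.sqrt_pos.2 (by exact_mod_cast hn)
    have hp := peak_pos n
    rw [couplingThreshold_eq, Real.norm_of_nonneg (by positivity),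
      Real.norm_of_nonneg (by positivity), ← mul_div_assoc,
      div_le_div_iff₀ hs (by positivity)]
    nlinarith [peak_le_sqrt hn]

lemma alphaThreshold_isTheta :
    (fun n : ℕ => alphaThreshold n) =Θ[atTop] (fun n : ℕ => 1 / (n : ℝ)) := by
  have hpi := Real.pi_gt_three
  have key : ∀ n : ℕ, 4 ≤ n →
      1 / 8 * (1 / (n : ℝ)) ≤ alphaThreshold n ∧ alphaThreshold n ≤ 4 * (1 / (n : ℝ)) := by
    intro n hn4
    have hn : 1 ≤ n := by omega
    have hn' : (4 : ℝ) ≤ n := by exact_mod_cast hn4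
    have hs : 0 < √(n : ℝ) := Real.sqrt_pos.2 (by linarith)
    have hss : √(n : ℝ) * √(n : ℝ) = n := Real.mul_self_sqrt (by linarith)
    have hp := peak_pos n
    have hsl := slope_pos hn
    have hsl1 : slope n ≤ 2 * √(n : ℝ) := by
      refine (slope_le hn).trans ?_
      rw [Real.sqrt_le_left (by positivity), mul_pow, sq √(n : ℝ), hss]
      linarith
    have hsl2 : √(n : ℝ) / 2 ≤ slope n := by
      refine le_trans ?_ (le_slope hn)
      gcongr
      linarith
    rw [alphaThreshold_eq hn, le_div_iff₀ hsl, div_le_iff₀ hsl]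
    have hfrac : (n : ℝ) / (n + 1) ≤ 1 := by
      rw [div_le_one (by linarith)]; linarith
    have hfrac2 : 4 / 5 ≤ (n : ℝ) / (n + 1) := by
      rw [div_le_div_iff₀ (by norm_num) (by linarith)]; linarith
    constructor
    · have h1 : 3 / (4 * √(n : ℝ)) ≤ π / (2 * peak n) := by
        rw [div_le_div_iff₀ (by positivity) (by positivity)]
        nlinarith [peak_le_sqrt hn]
      have h2 : 1 / 2 ^ n ≤ 1 / (4 * √(n : ℝ)) := by
        have h4 : (4 * n : ℝ) ≤ 2 ^ n := by exact_mod_cast four_mul_le_two_pow hn4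
        have h5 : √(n : ℝ) ≤ n := by
          rw [Real.sqrt_le_left (by linarith)]; nlinarith
        gcongr
        linarith
      -- In units of `1 / (4√n)`, the main term is at least `12/5` and the subtracted `1 / 2^n` at
      -- most `1`, so more than one unit remains.
      have h3 : 3 / (4 * √(n : ℝ)) * (4 / 5) ≤ π / (2 * peak n) * ((n : ℝ) / (n + 1)) := by
        gcongr
      have h4 : 1 / 8 * (1 / (n : ℝ)) * slope n ≤ 1 / (4 * √(n : ℝ)) := by
        calc 1 / 8 * (1 / (n : ℝ)) * slope n ≤ 1 / 8 * (1 / (n : ℝ)) * (2 * √(n : ℝ)) := by gcongr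
          _ = 1 / (4 * √(n : ℝ)) := by
            field_simp
            nlinarith
      have h5 : 3 / (4 * √(n : ℝ)) = 3 * (1 / (4 * √(n : ℝ))) := by ring
      have h6 : 0 < 1 / (4 * √(n : ℝ)) := by positivity
      rw [h5] at h3
      linarith
    · have h1 : π / (2 * peak n) ≤ 4 / (2 * √(n : ℝ)) := by
        have := sqrt_le_peak n
        have := Real.pi_le_four
        gcongr
      have h2 : π / (2 * peak n) * ((n : ℝ) / (n + 1)) ≤ π / (2 * peak n) :=
        mul_le_of_le_one_right (by positivity) hfrac
      have h3 : (0 : ℝ) < 1 / 2 ^ n := by positivity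
      have h4 : 4 / (2 * √(n : ℝ)) ≤ 4 * (1 / (n : ℝ)) * slope n := by
        calc 4 / (2 * √(n : ℝ)) = 4 * (1 / (n : ℝ)) * (√(n : ℝ) / 2) := by
              field_simp
              nlinarith
          _ ≤ _ := by gcongr
      linarith
  constructor
  · refine IsBigO.of_bound 4 ?_
    filter_upwards [eventually_ge_atTop 4] with n hn
    have h0 : (0 : ℝ) ≤ 1 / n := by positivity
    rw [Real.norm_of_nonneg (by linarith [(key n hn).1]), Real.norm_of_nonneg h0]
    exact (key n hn).2
  · refine IsBigO.of_bound 8 ?_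
    filter_upwards [eventually_ge_atTop 4] with n hn
    have h0 : (0 : ℝ) ≤ 1 / n := by positivity
    rw [Real.norm_of_nonneg h0, Real.norm_of_nonneg (by linarith [(key n hn).1])]
    linarith [(key n hn).1]

/-- The maximal slope `a_n √(2n-1) ((2n-1)/n)^(n-1)` of the influence function. -/
noncomputable def influenceLip (n : ℕ) : ℝ := peak n * slope n / 2

lemma influenceLip_pos {n : ℕ} (hn : 1 ≤ n) : 0 < influenceLip n := by
  have := peak_pos n
  have := slope_pos hn
  unfold influenceLip
  positivity

/-- The hypothesis on `α` in the form used later: the net growth over one turn is negative. -/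
lemma influenceLip_mul_lt {n : ℕ} {α : ℝ} (hn : 1 ≤ n) (h : α < alphaThreshold n) :
    4 * (influenceLip n * α) + 2 * coeff n < π * (n / (n + 1)) := by
  have hp := peak_pos n
  have hs := slope_pos hn
  rw [alphaThreshold_eq hn, lt_div_iff₀ hs] at h
  have h1 := mul_lt_mul_of_pos_left h (show 0 < 2 * peak n by positivity)
  have e1 : 2 * peak n * (π / (2 * peak n) * ((n : ℝ) / ((n : ℝ) + 1)) - 1 / 2 ^ n)
      = π * (n / (n + 1)) - 2 * coeff n := by
    have : peak n / 2 ^ n = coeff n := by unfold peak; field_simp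
    rw [← this]
    field_simp
  unfold influenceLip
  rw [e1] at h1
  linarith

/-- If `α ≥ 1`, then `4 L α ≥ 16/5 > π`. The bound serves the estimate `sin r ≥ 3r/4`, valid for `0
≤ r ≤ 1`. -/
lemma lt_one_of_lt_alphaThreshold {n : ℕ} {α : ℝ} (hn : 2 ≤ n) (h : α < alphaThreshold n) :
    α < 1 := by
  have hn' : (2 : ℝ) ≤ n := by exact_mod_cast hn
  have hn1 : 1 ≤ n := by omega
  have h1 := influenceLip_mul_lt hn1 h
  have hp : 2 ≤ peak n := by
    refine (abs_le_of_sq_le_sq' ?_ (peak_pos n).le).2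
    linarith [le_peak_sq n]
  have hs : 4 / 5 ≤ slope n := by
    refine le_trans ?_ (le_slope hn1)
    have : 8 / 5 ≤ √(2 * (n : ℝ) - 1) := by
      rw [Real.le_sqrt' (by norm_num)]
      norm_num
      linarith
    linarith
  have hc := coeff_pos n
  have h2 : π * (n / (n + 1)) ≤ π := by
    refine mul_le_of_le_one_right Real.pi_pos.le ?_
    rw [div_le_one (by linarith)]
    linarith
  have := Real.pi_lt_d2
  have hL : 4 / 5 ≤ influenceLip n := by
    unfold influenceLip
    nlinarith
  by_contra hα
  push Not at hα
  nlinarith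

end Winfree

/-! ### Slope of the influence function and integrals over one turn -/

namespace Winfree

/-- The maximum is at `u = 1`; passing from `m` to `m + 1` lowers the left side by `(m+1) u^m
(1-u)^2`. -/
lemma pow_mul_sub_le_one {u : ℝ} (hu : 0 ≤ u) (m : ℕ) :
    u ^ m * ((m + 1) - m * u) ≤ 1 := by
  induction m with
  | zero => simp
  | succ m ih =>
    have h : u ^ (m + 1) * (((m + 1 : ℕ) + 1) - (m + 1 : ℕ) * u)
        = u ^ m * ((m + 1) - m * u) - (m + 1) * (u ^ m * (1 - u) ^ 2) := by
      push_cast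
      ring
    rw [h]
    have : 0 ≤ (m + 1) * (u ^ m * (1 - u) ^ 2) := by positivity
    linarith

lemma influence_nonneg (n : ℕ) (x : ℝ) : 0 ≤ influence n x :=
  mul_nonneg (coeff_pos n).le (pow_nonneg (by linarith [Real.neg_one_le_cos x]) n)

lemma influence_le_peak (n : ℕ) (x : ℝ) : influence n x ≤ peak n := by
  unfold influence peak
  rw [mul_comm]
  have := (coeff_pos n).le
  have := Real.neg_one_le_cos x
  have := Real.cos_le_one x
  gcongr
  · linarith
  · linarith

lemma continuous_influence (n : ℕ) : Continuous (influence n) := by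
  unfold influence
  fun_prop

lemma influence_periodic (n : ℕ) : Function.Periodic (influence n) (2 * π) := fun x => by
  simp [influence]

lemma hasDerivAt_influence (n : ℕ) (x : ℝ) :
    HasDerivAt (influence n) (coeff n * (n * (1 + Real.cos x) ^ (n - 1) * -Real.sin x)) x :=
  (((Real.hasDerivAt_cos x).const_add 1).pow n).const_mul (coeff n)

lemma abs_deriv_influence_le {n : ℕ} (hn : 1 ≤ n) (x : ℝ) :
    |coeff n * (n * (1 + Real.cos x) ^ (n - 1) * -Real.sin x)| ≤ influenceLip n := by
  obtain ⟨m, rfl⟩ : ∃ m, n = m + 1 := ⟨n - 1, by omega⟩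
  have hA := coeff_pos (m + 1)
  refine abs_le_of_sq_le_sq ?_ (influenceLip_pos hn).le
  set c := Real.cos x
  have hs : Real.sin x ^ 2 = (1 + c) * (1 - c) := by
    rw [Real.sin_sq]; ring
  have hm1 : (0 : ℝ) < 2 * m + 1 := by positivity
  have hm2 : (0 : ℝ) < m + 1 := by positivity
  have hc : 0 ≤ 1 + c := by linarith [Real.neg_one_le_cos x]
  -- The squared derivative is a multiple of `(1+c)^(2m+1) (1-c)`; this scaling moves its maximum,
  -- at `c = m/(m+1)`, to `u = 1`.
  have key := pow_mul_sub_le_one (u := (1 + c) * (m + 1) / (2 * m + 1)) (by positivity) (2 * m + 1)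
  have e1 : (((2 * m + 1 : ℕ) : ℝ) + 1) - (2 * m + 1 : ℕ) * ((1 + c) * (m + 1) / (2 * m + 1))
      = (m + 1) * (1 - c) := by
    push_cast
    field_simp
    ring
  rw [e1] at key
  have e2 : (coeff (m + 1) * (((m + 1 : ℕ) : ℝ) * (1 + c) ^ (m + 1 - 1) * -Real.sin x)) ^ 2
      = coeff (m + 1) ^ 2 * ((2 * m + 1) * ((2 * m + 1) / (m + 1)) ^ (2 * m)) *
        (((1 + c) * (m + 1) / (2 * m + 1)) ^ (2 * m + 1) * ((m + 1) * (1 - c))) := by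
    have : (coeff (m + 1) * (((m + 1 : ℕ) : ℝ) * (1 + c) ^ (m + 1 - 1) * -Real.sin x)) ^ 2
      = coeff (m + 1) ^ 2 * ((m + 1) ^ 2 * ((1 + c) ^ m) ^ 2 * Real.sin x ^ 2) := by
      rw [Nat.add_sub_cancel]
      push_cast
      ring
    rw [this, hs, div_pow, div_pow, mul_pow, ← pow_mul, mul_comm m 2]
    field_simp
    ring
  have e3 : influenceLip (m + 1) ^ 2
      = coeff (m + 1) ^ 2 * ((2 * m + 1) * ((2 * m + 1) / (m + 1)) ^ (2 * m)) := by
    unfold influenceLip slope peak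
    rw [Nat.add_sub_cancel]
    have h2 : 2 * ((m + 1 : ℕ) : ℝ) - 1 = 2 * m + 1 := by push_cast; ring
    rw [h2, div_pow, mul_pow, mul_pow, mul_pow, Real.sq_sqrt hm1.le, ← pow_mul, ← pow_mul,
      mul_comm m 2, div_pow, div_pow]
    push_cast
    rw [mul_pow]
    field_simp
    ring
  rw [e2, e3]
  refine mul_le_of_le_one_right (by positivity) key

lemma abs_influence_sub_le {n : ℕ} (hn : 1 ≤ n) (x y : ℝ) :
    |influence n x - influence n y| ≤ influenceLip n * |x - y| := by
  have := Convex.norm_image_sub_le_of_norm_hasDerivWithin_le (f := influence n) (s := Set.univ)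
    (fun z _ => (hasDerivAt_influence n z).hasDerivWithinAt)
    (fun z _ => abs_deriv_influence_le hn z) convex_univ (Set.mem_univ y) (Set.mem_univ x)
  simpa [Real.norm_eq_abs] using this

/-- The derivative of the periodic function `(1 + cos x)^n sin x` integrates to zero. -/
lemma integral_one_add_cos_pow_mul_cos (n : ℕ) :
    (n + 1) * ∫ x in (0 : ℝ)..2 * π, (1 + Real.cos x) ^ n * Real.cos x
      = n * ∫ x in (0 : ℝ)..2 * π, (1 + Real.cos x) ^ n := by
  have hd : ∀ x : ℝ, HasDerivAt (fun x => (1 + Real.cos x) ^ n * Real.sin x)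
      ((n + 1) * ((1 + Real.cos x) ^ n * Real.cos x) - n * (1 + Real.cos x) ^ n) x := by
    intro x
    refine ((((Real.hasDerivAt_cos x).const_add 1).pow n).mul
      (Real.hasDerivAt_sin x)).congr_deriv ?_
    simp only [Pi.pow_apply]
    have hs : Real.sin x * Real.sin x = (1 + Real.cos x) * (1 - Real.cos x) := by
      rw [← sq, Real.sin_sq]; ring
    rcases n with _ | n
    · simp
    · have : ((n + 1 : ℕ) : ℝ) * (1 + Real.cos x) ^ (n + 1 - 1) * -Real.sin x * Real.sin x
          = -((n + 1 : ℕ) * (1 + Real.cos x) ^ n * (Real.sin x * Real.sin x)) := by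
        rw [Nat.add_sub_cancel]; ring
      rw [this, hs]
      push_cast
      ring
  have h := intervalIntegral.integral_eq_sub_of_hasDerivAt (a := 0) (b := 2 * π)
    (fun x _ => hd x) (Continuous.intervalIntegrable (by fun_prop) _ _)
  rw [intervalIntegral.integral_sub (Continuous.intervalIntegrable (by fun_prop) _ _)
    (Continuous.intervalIntegrable (by fun_prop) _ _), intervalIntegral.integral_const_mul,
    intervalIntegral.integral_const_mul] at h
  simp at h
  linarith

lemma integral_influence (n : ℕ) : ∫ x in (0 : ℝ)..2 * π, influence n x = 2 * π := by
  unfold influence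
  rw [intervalIntegral.integral_const_mul]
  induction n with
  | zero => simp [coeff_zero]
  | succ n ih =>
    have h1 : ∫ x in (0 : ℝ)..2 * π, (1 + Real.cos x) ^ (n + 1)
        = (∫ x in (0 : ℝ)..2 * π, (1 + Real.cos x) ^ n)
          + ∫ x in (0 : ℝ)..2 * π, (1 + Real.cos x) ^ n * Real.cos x := by
      rw [← intervalIntegral.integral_add (Continuous.intervalIntegrable (by fun_prop) _ _)
        (Continuous.intervalIntegrable (by fun_prop) _ _)]
      congr 1
      ext x
      ring
    have h2 := integral_one_add_cos_pow_mul_cos n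
    rw [h1, coeff_succ]
    set J := ∫ x in (0 : ℝ)..2 * π, (1 + Real.cos x) ^ n
    set C := ∫ x in (0 : ℝ)..2 * π, (1 + Real.cos x) ^ n * Real.cos x
    have h3 : (n + 1) * (J + C) = (2 * n + 1) * J := by linarith
    calc coeff n * ((n + 1) / (2 * n + 1)) * (J + C)
        = coeff n * ((n + 1) * (J + C)) / (2 * n + 1) := by ring
      _ = coeff n * J := by rw [h3]; field_simp
      _ = 2 * π := ih

lemma integral_influence_mul_cos (n : ℕ) :
    ∫ x in (0 : ℝ)..2 * π, influence n x * Real.cos x = 2 * (π * (n / (n + 1))) := by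
  have h1 := integral_influence n
  have h2 := integral_one_add_cos_pow_mul_cos n
  unfold influence at *
  simp only [mul_assoc]
  rw [intervalIntegral.integral_const_mul] at *
  set J := ∫ x in (0 : ℝ)..2 * π, (1 + Real.cos x) ^ n
  set C := ∫ x in (0 : ℝ)..2 * π, (1 + Real.cos x) ^ n * Real.cos x
  have h3 : C = n * J / (n + 1) := by
    field_simp
    linarith
  rw [h3]
  calc coeff n * (n * J / (n + 1)) = (coeff n * J) * (n / (n + 1)) := by ring
    _ = _ := by rw [h1]; ring

/-- The negative part of the cosine. -/
noncomputable def cosNeg (x : ℝ) : ℝ := max (-Real.cos x) 0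

/-- The negative part of the cosine, weighted by one plus the positive part of the sine. -/
noncomputable def cosNegWeighted (x : ℝ) : ℝ := cosNeg x * (1 + max (Real.sin x) 0)

lemma continuous_cosNeg : Continuous cosNeg := by unfold cosNeg; fun_prop

lemma continuous_cosNegWeighted : Continuous cosNegWeighted := by
  have := continuous_cosNeg
  unfold cosNegWeighted
  fun_prop

lemma cosNeg_nonneg (x : ℝ) : 0 ≤ cosNeg x := le_max_right _ _

lemma cosNeg_le_cosNegWeighted (x : ℝ) : cosNeg x ≤ cosNegWeighted x :=
  le_mul_of_one_le_right (cosNeg_nonneg x) (by linarith [le_max_right (Real.sin x) 0])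

lemma cosNegWeighted_nonneg (x : ℝ) : 0 ≤ cosNegWeighted x :=
  (cosNeg_nonneg x).trans (cosNeg_le_cosNegWeighted x)

lemma cosNeg_of_cos_nonneg {x : ℝ} (h : 0 ≤ Real.cos x) : cosNeg x = 0 :=
  max_eq_right (by linarith)

lemma cosNeg_of_cos_nonpos {x : ℝ} (h : Real.cos x ≤ 0) : cosNeg x = -Real.cos x :=
  max_eq_left (by linarith)

lemma integral_eq_zero_add_quarters {f : ℝ → ℝ} (hf : Continuous f)
    (h : ∀ x, 0 ≤ Real.cos x → f x = 0) :
    ∫ x in (0 : ℝ)..2 * π, f x = (∫ x in (π / 2)..π, f x) + ∫ x in π..(π + π / 2), f x := by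
  have hpi := Real.pi_pos
  have hi : ∀ a b, IntervalIntegrable f MeasureTheory.volume a b :=
    fun a b => hf.intervalIntegrable a b
  have h1 : ∫ x in (0 : ℝ)..π / 2, f x = 0 := by
    refine intervalIntegral.integral_zero_ae (Eventually.of_forall fun x hx => h x ?_)
    rw [uIoc_of_le (by linarith)] at hx
    exact Real.cos_nonneg_of_neg_pi_div_two_le_of_le (by linarith [hx.1]) hx.2
  have h2 : ∫ x in (π + π / 2)..2 * π, f x = 0 := by
    refine intervalIntegral.integral_zero_ae (Eventually.of_forall fun x hx => h x ?_)
    rw [uIoc_of_le (by linarith)] at hx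
    rw [← Real.cos_sub_two_pi]
    exact Real.cos_nonneg_of_neg_pi_div_two_le_of_le (by linarith [hx.1]) (by linarith [hx.2])
  rw [← intervalIntegral.integral_add_adjacent_intervals (hi 0 (π / 2)) (hi _ _),
    ← intervalIntegral.integral_add_adjacent_intervals (hi (π / 2) π) (hi _ _),
    ← intervalIntegral.integral_add_adjacent_intervals (hi π (π + π / 2)) (hi _ _), h1, h2]
  ring

lemma cos_nonpos_of_mem {x : ℝ} (h1 : π / 2 ≤ x) (h2 : x ≤ π + π / 2) : Real.cos x ≤ 0 :=
  Real.cos_nonpos_of_pi_div_two_le_of_le h1 h2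

lemma integral_cosNeg : ∫ x in (0 : ℝ)..2 * π, cosNeg x = 2 := by
  have hpi := Real.pi_pos
  rw [integral_eq_zero_add_quarters continuous_cosNeg fun x h => cosNeg_of_cos_nonneg h,
    intervalIntegral.integral_add_adjacent_intervals (continuous_cosNeg.intervalIntegrable _ _)
      (continuous_cosNeg.intervalIntegrable _ _)]
  have : ∫ x in (π / 2)..(π + π / 2), cosNeg x = ∫ x in (π / 2)..(π + π / 2), -Real.cos x := by
    refine intervalIntegral.integral_congr fun x hx => ?_
    rw [uIcc_of_le (by linarith)] at hx
    exact cosNeg_of_cos_nonpos (cos_nonpos_of_mem hx.1 hx.2)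
  rw [this, intervalIntegral.integral_neg, integral_cos, add_comm π, Real.sin_add_pi,
    Real.sin_pi_div_two]
  norm_num

lemma integral_cosNegWeighted : ∫ x in (0 : ℝ)..2 * π, cosNegWeighted x = 5 / 2 := by
  have hpi := Real.pi_pos
  rw [integral_eq_zero_add_quarters continuous_cosNegWeighted fun x h => by
    simp [cosNegWeighted, cosNeg_of_cos_nonneg h]]
  have h1 : ∫ x in (π / 2)..π, cosNegWeighted x = 3 / 2 := by
    have : ∫ x in (π / 2)..π, cosNegWeighted x
        = ∫ x in (π / 2)..π, -Real.cos x * (1 + Real.sin x) := by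
      refine intervalIntegral.integral_congr fun x hx => ?_
      rw [uIcc_of_le (by linarith)] at hx
      simp only [cosNegWeighted]
      rw [cosNeg_of_cos_nonpos (cos_nonpos_of_mem hx.1 (by linarith [hx.2])),
        max_eq_left (Real.sin_nonneg_of_nonneg_of_le_pi (by linarith [hx.1]) hx.2)]
    rw [this]
    have hd : ∀ x : ℝ, HasDerivAt (fun x => -((1 + Real.sin x) ^ 2 / 2))
        (-Real.cos x * (1 + Real.sin x)) x := fun x => by
      refine ((((Real.hasDerivAt_sin x).const_add 1).pow 2).div_const 2).neg.congr_deriv ?_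
      push_cast
      ring
    rw [intervalIntegral.integral_eq_sub_of_hasDerivAt (fun x _ => hd x)
      (Continuous.intervalIntegrable (by fun_prop) _ _)]
    norm_num
  have h2 : ∫ x in π..(π + π / 2), cosNegWeighted x = 1 := by
    have : ∫ x in π..(π + π / 2), cosNegWeighted x = ∫ x in π..(π + π / 2), -Real.cos x := by
      refine intervalIntegral.integral_congr fun x hx => ?_
      rw [uIcc_of_le (by linarith)] at hx
      have hs : Real.sin x ≤ 0 := by
        rw [← Real.sin_sub_two_pi]
        exact Real.sin_nonpos_of_nonpos_of_neg_pi_le (by linarith [hx.2]) (by linarith [hx.1])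
      simp only [cosNegWeighted]
      rw [cosNeg_of_cos_nonpos (cos_nonpos_of_mem (by linarith [hx.1]) hx.2), max_eq_right hs]
      ring
    rw [this, intervalIntegral.integral_neg, integral_cos, add_comm π, Real.sin_add_pi,
      Real.sin_pi_div_two]
    simp
  rw [h1, h2]
  norm_num

/-- The part of the logarithmic rate of change of the half-diameter, per unit of phase and up to
the factor `κ / ν`, that increases it. -/
noncomputable def growthRate (n : ℕ) (δ x : ℝ) : ℝ := (influence n x + δ) * cosNegWeighted x

/-- The part of the logarithmic rate of change of the half-diameter, per unit of phase and up to
the factor `κ / ν`, that decreases it. -/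
noncomputable def decayRate (n : ℕ) (δ x : ℝ) : ℝ :=
  1 / 2 * (max (influence n x - δ) 0 * max (Real.cos x) 0)

lemma continuous_growthRate (n : ℕ) (δ : ℝ) : Continuous (growthRate n δ) := by
  have := continuous_influence n
  have := continuous_cosNegWeighted
  unfold growthRate
  fun_prop

lemma continuous_decayRate (n : ℕ) (δ : ℝ) : Continuous (decayRate n δ) := by
  have := continuous_influence n
  unfold decayRate
  fun_prop

lemma growthRate_nonneg {n : ℕ} {δ : ℝ} (hδ : 0 ≤ δ) (x : ℝ) : 0 ≤ growthRate n δ x :=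
  mul_nonneg (add_nonneg (influence_nonneg n x) hδ) (cosNegWeighted_nonneg x)

lemma decayRate_nonneg (n : ℕ) (δ x : ℝ) : 0 ≤ decayRate n δ x := by
  unfold decayRate
  positivity

lemma growthRate_periodic (n : ℕ) (δ : ℝ) : Function.Periodic (growthRate n δ) (2 * π) :=
  fun x => by simp [growthRate, cosNegWeighted, cosNeg, influence_periodic n x]

lemma decayRate_periodic (n : ℕ) (δ : ℝ) : Function.Periodic (decayRate n δ) (2 * π) :=
  fun x => by simp [decayRate, influence_periodic n x]

lemma influence_le_coeff {n : ℕ} {x : ℝ} (h : Real.cos x ≤ 0) : influence n x ≤ coeff n :=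
  mul_le_of_le_one_right (coeff_pos n).le
    (pow_le_one₀ (by linarith [Real.neg_one_le_cos x]) (by linarith))

lemma integral_growthRate_le (n : ℕ) {δ : ℝ} :
    ∫ x in (0 : ℝ)..2 * π, growthRate n δ x ≤ 5 / 2 * (coeff n + δ) := by
  have hpi := Real.pi_pos
  have hW := continuous_cosNegWeighted
  rw [mul_comm (5 / 2 : ℝ), ← integral_cosNegWeighted, ← intervalIntegral.integral_const_mul]
  refine intervalIntegral.integral_mono_on (by linarith)
    ((continuous_growthRate n δ).intervalIntegrable _ _)
    (Continuous.intervalIntegrable (by fun_prop) _ _) fun x _ => ?_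
  unfold growthRate
  rcases le_total 0 (Real.cos x) with h | h
  · simp [cosNegWeighted, cosNeg_of_cos_nonneg h]
  · have := influence_le_coeff (n := n) h
    have := cosNegWeighted_nonneg x
    gcongr

lemma integral_growthRate_sub_decayRate_le (n : ℕ) {δ : ℝ} :
    ∫ x in (0 : ℝ)..2 * π, (growthRate n δ x - decayRate n δ x)
      ≤ 3 / 2 * coeff n + 7 / 2 * δ - π * (n / (n + 1)) := by
  have hpi := Real.pi_pos
  have hW := continuous_cosNegWeighted
  have hN := continuous_cosNeg
  have hI := continuous_influence n
  -- This majorant is exact where `cos x ≥ 0` and uses no positive parts of `influence n x - δ`, so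
  -- its integral is explicit.
  have hint : ∫ x in (0 : ℝ)..2 * π, ((coeff n + δ) * cosNegWeighted x
        - (coeff n - δ) / 2 * cosNeg x + δ / 2 * Real.cos x
        - 1 / 2 * (influence n x * Real.cos x))
      = 3 / 2 * coeff n + 7 / 2 * δ - π * (n / (n + 1)) := by
    rw [intervalIntegral.integral_sub, intervalIntegral.integral_add, intervalIntegral.integral_sub,
      intervalIntegral.integral_const_mul, intervalIntegral.integral_const_mul,
      intervalIntegral.integral_const_mul, intervalIntegral.integral_const_mul,
      integral_cosNegWeighted, integral_cosNeg, integral_influence_mul_cos, integral_cos]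
    · simp
      ring
    all_goals exact Continuous.intervalIntegrable (by fun_prop) _ _
  rw [← hint]
  refine intervalIntegral.integral_mono_on (by linarith)
    (((continuous_growthRate n δ).sub (continuous_decayRate n δ)).intervalIntegrable _ _)
    (Continuous.intervalIntegrable (by fun_prop) _ _) fun x _ => ?_
  unfold growthRate decayRate
  have h0 := le_max_left (influence n x - δ) 0
  rcases le_total 0 (Real.cos x) with h | h
  · simp only [cosNegWeighted, cosNeg_of_cos_nonneg h, max_eq_left h]
    nlinarith [mul_le_mul_of_nonneg_right h0 h]
  · rw [max_eq_right h]
    have h1 := influence_le_coeff (n := n) h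
    have h2 := cosNeg_le_cosNegWeighted x
    have h3 := cosNeg_nonneg x
    have h4 := cosNeg_of_cos_nonpos h
    -- Where `cos x ≤ 0`, the majorant exceeds the integrand by exactly this product.
    have h5 := mul_nonneg (sub_nonneg.2 h1) (show 0 ≤ cosNegWeighted x - cosNeg x / 2 by linarith)
    have h6 : Real.cos x = -cosNeg x := by linarith
    rw [h6]
    nlinarith

end Winfree

/-! ### Integrals of periodic functions and differential inequalities -/

namespace Winfree

/-- Each of the `k` full periods contributes at most `-μ`; the remainder, shorter than `T`, costs at
most one period of `g`. The extra `μ` pays for rounding `(b - a) / T` down to `k`. -/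
lemma integral_periodic_le {T μ : ℝ} (hT : 0 < T) (hμ : 0 ≤ μ) {f g : ℝ → ℝ}
    (hf : Continuous f) (hg : Continuous g) (hfp : Function.Periodic f T)
    (hgp : Function.Periodic g T) (hfg : ∀ x, f x ≤ g x) (hg0 : ∀ x, 0 ≤ g x)
    (hint : ∫ x in (0 : ℝ)..T, f x ≤ -μ) {a b : ℝ} (hab : a ≤ b) :
    ∫ x in a..b, f x ≤ (∫ x in (0 : ℝ)..T, g x) + μ - μ / T * (b - a) := by
  set k := ⌊(b - a) / T⌋₊
  have hk1 : k * T ≤ b - a := by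
    rw [← le_div_iff₀ hT]
    exact Nat.floor_le (div_nonneg (by linarith) hT.le)
  have hk2 : b - a < (k + 1) * T := by
    rw [← div_lt_iff₀ hT]
    exact Nat.lt_floor_add_one _
  have hfi : ∀ a b, IntervalIntegrable f MeasureTheory.volume a b :=
    fun a b => hf.intervalIntegrable a b
  have hgi : ∀ a b, IntervalIntegrable g MeasureTheory.volume a b :=
    fun a b => hg.intervalIntegrable a b
  have h1 : ∫ x in a..(a + k * T), f x = k * ∫ x in (0 : ℝ)..T, f x := by
    have := hfp.intervalIntegral_add_zsmul_eq k a hfi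
    simpa [hfp.intervalIntegral_add_eq a 0] using this
  have h2 : ∫ x in (a + k * T)..b, f x ≤ ∫ x in (0 : ℝ)..T, g x := by
    calc ∫ x in (a + k * T)..b, f x ≤ ∫ x in (a + k * T)..b, g x :=
          intervalIntegral.integral_mono_on (by linarith) (hfi _ _) (hgi _ _) fun x _ => hfg x
      _ ≤ ∫ x in (a + k * T)..(a + k * T + T), g x :=
          intervalIntegral.integral_mono_interval le_rfl (by linarith) (by linarith)
            (Eventually.of_forall hg0) (hgi _ _)
      _ = ∫ x in (0 : ℝ)..T, g x := by
          rw [hgp.intervalIntegral_add_eq _ 0, zero_add]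
  rw [← intervalIntegral.integral_add_adjacent_intervals (hfi a (a + k * T)) (hfi _ b), h1]
  have h3 : (k : ℝ) * ∫ x in (0 : ℝ)..T, f x ≤ k * -μ := by gcongr
  have h4 : μ / T * (b - a) ≤ μ / T * ((k + 1) * T) := by gcongr
  have h5 : μ / T * ((k + 1) * T) = μ * k + μ := by field_simp
  linarith

lemma exists_abs_integral_periodic_sub_le {T : ℝ} (hT : 0 < T) {f : ℝ → ℝ} (hf : Continuous f)
    (hfp : Function.Periodic f T) :
    ∃ C : ℝ, ∀ a b : ℝ, a ≤ b →
      |(∫ x in a..b, f x) - (∫ x in (0 : ℝ)..T, f x) / T * (b - a)| ≤ C := by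
  set m := (∫ x in (0 : ℝ)..T, f x) / T
  refine ⟨∫ x in (0 : ℝ)..T, |f x - m|, fun a b hab => ?_⟩
  have hc : Continuous fun x => f x - m := by fun_prop
  have hp : Function.Periodic (fun x => f x - m) T := fun x => by simp [hfp x]
  have hap : Function.Periodic (fun x => |f x - m|) T := fun x => by simp [hfp x]
  have hsub : ∀ a b, ∫ x in a..b, (f x - m) = (∫ x in a..b, f x) - m * (b - a) := fun a b => by
    rw [intervalIntegral.integral_sub (hf.intervalIntegrable _ _)
      (Continuous.intervalIntegrable (by fun_prop) _ _), intervalIntegral.integral_const,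
      smul_eq_mul, mul_comm]
  have h0 : ∫ x in (0 : ℝ)..T, (f x - m) = 0 := by
    rw [hsub, sub_zero, div_mul_cancel₀ _ hT.ne', sub_self]
  have h1 := integral_periodic_le hT le_rfl hc hc.abs hp hap (fun x => le_abs_self _)
    (fun x => abs_nonneg _) (by rw [h0, neg_zero]) hab
  have h2 := integral_periodic_le (f := fun x => -(f x - m)) hT le_rfl hc.neg hc.abs (fun x => by simp [hfp x]) hap
    (fun x => neg_le_abs _) (fun x => abs_nonneg _)
    (by rw [intervalIntegral.integral_neg, h0, neg_zero]) hab
  rw [intervalIntegral.integral_neg] at h2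
  rw [zero_div, zero_mul] at h1 h2
  rw [← hsub, abs_le]
  constructor <;> linarith

lemma le_of_hasDerivWithinAt_nonpos {f f' : ℝ → ℝ} {T : ℝ} (hT : 0 ≤ T)
    (hf : ∀ t ∈ Icc 0 T, HasDerivWithinAt f (f' t) (Ici 0) t) (h : ∀ t ∈ Icc 0 T, f' t ≤ 0) :
    f T ≤ f 0 := by
  have hsub : Icc 0 T ⊆ Ici (0 : ℝ) := fun t ht => ht.1
  refine antitoneOn_of_hasDerivWithinAt_nonpos (f' := f') (convex_Icc 0 T)
    (fun t ht => ((hf t ht).mono hsub).continuousWithinAt)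
    (fun t ht => (hf t (interior_subset ht)).mono (interior_subset.trans hsub))
    (fun t ht => h t (interior_subset ht)) (left_mem_Icc.2 hT) (right_mem_Icc.2 hT) hT

lemma le_of_hasDerivWithinAt_nonneg {f f' : ℝ → ℝ} {T : ℝ} (hT : 0 ≤ T)
    (hf : ∀ t ∈ Icc 0 T, HasDerivWithinAt f (f' t) (Ici 0) t) (h : ∀ t ∈ Icc 0 T, 0 ≤ f' t) :
    f 0 ≤ f T := by
  have := le_of_hasDerivWithinAt_nonpos hT (fun t ht => (hf t ht).neg)
    (fun t ht => neg_nonpos.2 (h t ht))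
  simpa using this

lemma nonneg_of_linear_ode {D g : ℝ → ℝ} (hg : ContinuousOn g (Ici 0))
    (hD : ∀ t, 0 ≤ t → HasDerivWithinAt D (g t * D t) (Ici 0) t) (h0 : 0 ≤ D 0) {t : ℝ}
    (ht : 0 ≤ t) : 0 ≤ D t := by
  -- Freezing `g` on negative times makes the coefficient continuous on the whole line, so its
  -- primitive is differentiable at `0` too.
  set e : ℝ → ℝ := fun s => g (max s 0)
  have he : Continuous e := hg.comp_continuous (by fun_prop) fun s => mem_Ici.2 (le_max_right _ _)
  set A : ℝ → ℝ := fun t => ∫ s in (0 : ℝ)..t, e s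
  have hA : ∀ t, HasDerivAt A (e t) t := fun t => he.integral_hasStrictDerivAt 0 t |>.hasDerivAt
  have hmul : ∀ s, 0 ≤ s →
      HasDerivWithinAt (fun s => D s * Real.exp (-A s)) 0 (Ici 0) s := fun s hs => by
    refine ((hD s hs).mul (hA s).neg.exp.hasDerivWithinAt).congr_deriv ?_
    simp only [e, max_eq_left hs]
    ring
  have h1 := le_of_hasDerivWithinAt_nonneg ht (fun s hs => hmul s hs.1) (fun _ _ => le_rfl)
  have h2 : 0 ≤ D t * Real.exp (-A t) := le_trans (by positivity) h1
  exact nonneg_of_mul_nonneg_left h2 (Real.exp_pos _)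

end Winfree

/-! ### Order preservation and the pointwise estimate -/

namespace Winfree

/-- The mean of the influences of all oscillators. -/
noncomputable def meanInfluence {N : ℕ} (n : ℕ) (θ : Fin N → ℝ → ℝ) (t : ℝ) : ℝ :=
  1 / (N : ℝ) * ∑ j : Fin N, influence n (θ j t)

lemma meanInfluence_nonneg {N : ℕ} (n : ℕ) (θ : Fin N → ℝ → ℝ) (t : ℝ) :
    0 ≤ meanInfluence n θ t :=
  mul_nonneg (by positivity) (Finset.sum_nonneg fun j _ => influence_nonneg n _)

lemma abs_meanInfluence_sub_le {N : ℕ} (hN : 0 < N) (n : ℕ) (θ : Fin N → ℝ → ℝ) (t c C : ℝ)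
    (h : ∀ j, |influence n (θ j t) - c| ≤ C) : |meanInfluence n θ t - c| ≤ C := by
  have hN' : (0 : ℝ) < N := by exact_mod_cast hN
  have e : meanInfluence n θ t - c = 1 / (N : ℝ) * ∑ j : Fin N, (influence n (θ j t) - c) := by
    rw [Finset.sum_sub_distrib, meanInfluence]
    simp
    field_simp
  rw [e, abs_mul, abs_of_pos (by positivity)]
  calc 1 / (N : ℝ) * |∑ j : Fin N, (influence n (θ j t) - c)|
      ≤ 1 / (N : ℝ) * ∑ j : Fin N, C := by
        gcongr
        exact (Finset.abs_sum_le_sum_abs _ _).trans (Finset.sum_le_sum fun j _ => h j)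
    _ = C := by simp; field_simp

lemma meanInfluence_le_peak {N : ℕ} (hN : 0 < N) (n : ℕ) (θ : Fin N → ℝ → ℝ) (t : ℝ) :
    meanInfluence n θ t ≤ peak n := by
  have hN' : (0 : ℝ) < N := by exact_mod_cast hN
  calc meanInfluence n θ t ≤ 1 / (N : ℝ) * ∑ j : Fin N, peak n := by
        unfold meanInfluence
        gcongr
        exact influence_le_peak n _
    _ = peak n := by simp; field_simp

section Solution

variable {N n : ℕ} {κ ν : ℝ} {freq : Fin N → ℝ} {θ : Fin N → ℝ → ℝ}

lemma IsGlobalSolution.hasDerivWithinAt (h : IsGlobalSolution n κ freq θ) (hfreq : ∀ i, freq i = ν)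
    (i : Fin N) {t : ℝ} (ht : 0 ≤ t) :
    HasDerivWithinAt (θ i) (ν - κ * meanInfluence n θ t * Real.sin (θ i t)) (Ici 0) t := by
  refine (h i t ht).congr_deriv ?_
  rw [hfreq, ← Finset.sum_mul]
  unfold meanInfluence sensitivity
  ring

lemma IsGlobalSolution.continuousOn (h : IsGlobalSolution n κ freq θ) (i : Fin N) :
    ContinuousOn (θ i) (Ici 0) := fun t ht => (h i t ht).continuousWithinAt

lemma IsGlobalSolution.continuousOn_meanInfluence (h : IsGlobalSolution n κ freq θ) :
    ContinuousOn (meanInfluence n θ) (Ici 0) :=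
  continuousOn_const.mul (continuousOn_finsetSum _ fun j _ =>
    (continuous_influence n).comp_continuousOn (h.continuousOn j))

lemma sin_sub_sin_eq_sinc (x y : ℝ) :
    Real.sin x - Real.sin y = Real.sinc ((x - y) / 2) * Real.cos ((x + y) / 2) * (x - y) := by
  rw [Real.sin_sub_sin]
  rcases eq_or_ne x y with rfl | hxy
  · simp
  · have : (x - y) / 2 ≠ 0 := div_ne_zero (sub_ne_zero.2 hxy) two_ne_zero
    rw [Real.sinc_of_ne_zero this]
    have : x - y ≠ 0 := sub_ne_zero.2 hxy
    field_simp

/-- Writing the difference of sines with `sinc` shows that the gap of two phases solves a linear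
equation with continuous coefficient, even where the phases meet; its sign persists. -/
lemma IsGlobalSolution.order_preserved (h : IsGlobalSolution n κ freq θ)
    (hfreq : ∀ i, freq i = ν) {i j : Fin N} (h0 : θ i 0 ≤ θ j 0) {t : ℝ} (ht : 0 ≤ t) :
    θ i t ≤ θ j t := by
  have hi := h.continuousOn i
  have hj := h.continuousOn j
  have hm := h.continuousOn_meanInfluence
  have hsinc : ContinuousOn (fun t => Real.sinc ((θ j t - θ i t) / 2)) (Ici 0) :=
    Real.continuous_sinc.comp_continuousOn ((hj.sub hi).div_const 2)
  have hcos : ContinuousOn (fun t => Real.cos ((θ j t + θ i t) / 2)) (Ici 0) :=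
    Real.continuous_cos.comp_continuousOn ((hj.add hi).div_const 2)
  have := nonneg_of_linear_ode (D := fun t => θ j t - θ i t)
    (g := fun t => -κ * meanInfluence n θ t * (Real.sinc ((θ j t - θ i t) / 2) *
      Real.cos ((θ j t + θ i t) / 2)))
    ((continuousOn_const.mul hm).mul (hsinc.mul hcos))
    (fun t ht => ((h.hasDerivWithinAt hfreq j ht).sub
      (h.hasDerivWithinAt hfreq i ht)).congr_deriv (by
        have := sin_sub_sin_eq_sinc (θ j t) (θ i t)
        linear_combination (-κ * meanInfluence n θ t) * this)) (sub_nonneg.2 h0) ht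
  exact sub_nonneg.1 this

lemma IsGlobalSolution.exists_extremal (h : IsGlobalSolution n κ freq θ)
    (hfreq : ∀ i, freq i = ν) (hN : 0 < N) :
    ∃ a b : Fin N, ∀ t, 0 ≤ t → (∀ j, θ a t ≤ θ j t ∧ θ j t ≤ θ b t) ∧
      halfDiameter θ t = (θ b t - θ a t) / 2 := by
  have : Nonempty (Fin N) := ⟨⟨0, hN⟩⟩
  obtain ⟨a, ha⟩ := Finite.exists_min fun i => θ i 0
  obtain ⟨b, hb⟩ := Finite.exists_max fun i => θ i 0
  refine ⟨a, b, fun t ht => ?_⟩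
  have hj : ∀ j, θ a t ≤ θ j t ∧ θ j t ≤ θ b t := fun j =>
    ⟨h.order_preserved hfreq (ha j) ht, h.order_preserved hfreq (hb j) ht⟩
  refine ⟨hj, ?_⟩
  have h1 : ⨆ i, θ i t = θ b t :=
    le_antisymm (ciSup_le fun j => (hj j).2) (le_ciSup (f := fun i => θ i t) (Finite.bddAbove_range _) b)
  have h2 : ⨅ i, θ i t = θ a t :=
    le_antisymm (ciInf_le (f := fun i => θ i t) (Finite.bddBelow_range _) a) (le_ciInf fun j => (hj j).1)
  rw [halfDiameter, h1, h2]

end Solution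

/-- The pointwise comparison between the rate of change of the half-diameter `r` and the phase
speed, for a mean field `I` that is `δ`-close to the influence at the phase `x`. -/
lemma neg_mul_cos_mul_sin_le {n : ℕ} {κ ν δ I r x : ℝ} (hν : 0 < ν) (hκ : 0 < κ) (hI0 : 0 ≤ I)
    (hκI : κ * I ≤ ν / 2) (hI : |I - influence n x| ≤ δ) (hr0 : 0 ≤ r) (hr1 : r ≤ 1) :
    -κ * I * Real.cos x * Real.sin r ≤
      κ / ν * (growthRate n δ x - decayRate n δ x) * (ν - κ * I * Real.cos r * Real.sin x) * r := by
  have hcr0 : 0 ≤ Real.cos r :=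
    Real.cos_nonneg_of_neg_pi_div_two_le_of_le (by linarith [Real.pi_gt_three])
      (by linarith [Real.pi_gt_three])
  have hcr1 := Real.cos_le_one r
  have hq0 : 0 ≤ κ * I := by positivity
  have hqc : κ * I * Real.cos r ≤ ν / 2 := (mul_le_of_le_one_right hq0 hcr1).trans hκI
  have hqc0 : 0 ≤ κ * I * Real.cos r := by positivity
  have hs1 := Real.neg_one_le_sin x
  have hs2 := Real.sin_le_one x
  rw [abs_le] at hI
  set v := ν - κ * I * Real.cos r * Real.sin x with hv
  have hv2 : v ≤ 3 / 2 * ν := by rw [hv]; nlinarith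
  have hv1 : ν / 2 ≤ v := by rw [hv]; nlinarith
  have hsr : Real.sin r ≤ r := Real.sin_le hr0
  have hsr0 : 0 ≤ Real.sin r :=
    Real.sin_nonneg_of_nonneg_of_le_pi hr0 (by linarith [Real.pi_gt_three])
  have hsr2 : 3 / 4 * r ≤ Real.sin r := by
    rcases hr0.eq_or_lt with rfl | hr
    · simp
    · have := Real.sin_gt_sub_cube hr
      nlinarith [mul_nonneg hr0 (show 0 ≤ 1 - r ^ 2 by nlinarith)]
  rcases le_total 0 (Real.cos x) with hc | hc
  · have hg : growthRate n δ x = 0 := by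
      simp [growthRate, cosNegWeighted, cosNeg_of_cos_nonneg hc]
    rw [hg, decayRate, max_eq_left hc]
    set m := max (influence n x - δ) 0
    have hm0 : 0 ≤ m := le_max_right _ _
    have hmI : m ≤ I := max_le (by linarith) hI0
    -- The factor `1/2` in `decayRate` is what `v ≤ 3ν/2` and `sin r ≥ 3r/4` leave: `2/3 * 3/4`.
    have h1 : m * v * r ≤ I * (3 / 2 * ν) * (4 / 3 * Real.sin r) := by
      gcongr <;> linarith
    have h2 := mul_le_mul_of_nonneg_left h1 (show 0 ≤ κ / ν * (1 / 2 * Real.cos x) by positivity)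
    have h3 : κ / ν * (1 / 2 * Real.cos x) * (I * (3 / 2 * ν) * (4 / 3 * Real.sin r))
        = κ * I * Real.cos x * Real.sin r := by
      field_simp
      ring
    rw [h3] at h2
    linarith
  · have hd : decayRate n δ x = 0 := by simp [decayRate, max_eq_right hc]
    rw [hd, sub_zero, growthRate, cosNegWeighted, cosNeg_of_cos_nonpos hc]
    set s := max (Real.sin x) 0
    have hs0 : 0 ≤ s := le_max_right _ _
    have hsx : Real.sin x ≤ s := le_max_left _ _
    have hs1' : s ≤ 1 := max_le hs2 zero_le_one
    -- The sine weight in `cosNegWeighted` compensates a slow midpoint: `(1 + s)(1 - s/2) ≥ 1` for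
    -- `0 ≤ s ≤ 1`.
    have hvs : ν ≤ (1 + s) * v := by
      have h1 : ν * (1 - s / 2) ≤ v := by
        rw [hv]
        nlinarith [mul_le_mul_of_nonneg_left hsx hqc0, mul_le_mul_of_nonneg_right hqc hs0]
      have h2 : (1 + s) * (ν * (1 - s / 2)) ≤ (1 + s) * v := by gcongr
      nlinarith [mul_nonneg hν.le (mul_nonneg hs0 (sub_nonneg.2 hs1'))]
    have h1 : I * ν * Real.sin r ≤ (influence n x + δ) * ((1 + s) * v) * r := by
      have hIδ : I ≤ influence n x + δ := by linarith
      exact (mul_le_mul_of_nonneg_left hsr (by positivity)).trans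
        (mul_le_mul_of_nonneg_right (mul_le_mul hIδ hvs hν.le (by linarith)) hr0)
    have h2 := mul_le_mul_of_nonneg_left h1
      (show 0 ≤ κ / ν * -Real.cos x from mul_nonneg (by positivity) (by linarith))
    have h3 : κ / ν * -Real.cos x * (I * ν * Real.sin r)
        = -κ * I * Real.cos x * Real.sin r := by
      field_simp
    rw [h3] at h2
    linarith

end Winfree

/-! ### Contraction of the half-gap, with the midpoint as clock -/

namespace Winfree

section Solution

variable {N n : ℕ} {κ ν : ℝ} {freq : Fin N → ℝ} {θ : Fin N → ℝ → ℝ}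

/-- The midpoint of the two phases `θ a` and `θ b`. -/
noncomputable def midpoint (θ : Fin N → ℝ → ℝ) (a b : Fin N) (t : ℝ) : ℝ := (θ b t + θ a t) / 2

/-- Half the difference of the two phases `θ b` and `θ a`. -/
noncomputable def halfGap (θ : Fin N → ℝ → ℝ) (a b : Fin N) (t : ℝ) : ℝ := (θ b t - θ a t) / 2

lemma IsGlobalSolution.hasDerivWithinAt_midpoint (h : IsGlobalSolution n κ freq θ)
    (hfreq : ∀ i, freq i = ν) (a b : Fin N) {t : ℝ} (ht : 0 ≤ t) :
    HasDerivWithinAt (midpoint θ a b) (ν - κ * meanInfluence n θ t *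
      Real.cos (halfGap θ a b t) * Real.sin (midpoint θ a b t)) (Ici 0) t := by
  refine (((h.hasDerivWithinAt hfreq b ht).add (h.hasDerivWithinAt hfreq a ht)).div_const
    2).congr_deriv ?_
  have e1 : θ b t = midpoint θ a b t + halfGap θ a b t := by unfold midpoint halfGap; ring
  have e2 : θ a t = midpoint θ a b t - halfGap θ a b t := by unfold midpoint halfGap; ring
  rw [e1, e2, Real.sin_add, Real.sin_sub]
  ring

lemma IsGlobalSolution.hasDerivWithinAt_halfGap (h : IsGlobalSolution n κ freq θ)
    (hfreq : ∀ i, freq i = ν) (a b : Fin N) {t : ℝ} (ht : 0 ≤ t) :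
    HasDerivWithinAt (halfGap θ a b) (-κ * meanInfluence n θ t *
      Real.cos (midpoint θ a b t) * Real.sin (halfGap θ a b t)) (Ici 0) t := by
  refine (((h.hasDerivWithinAt hfreq b ht).sub (h.hasDerivWithinAt hfreq a ht)).div_const
    2).congr_deriv ?_
  have e1 : θ b t = midpoint θ a b t + halfGap θ a b t := by unfold midpoint halfGap; ring
  have e2 : θ a t = midpoint θ a b t - halfGap θ a b t := by unfold midpoint halfGap; ring
  rw [e1, e2, Real.sin_add, Real.sin_sub]
  ring

lemma mul_meanInfluence_le_half (hN : 0 < N) (hκ : 0 < κ) (hκν : κ < couplingThreshold n ν)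
    (t : ℝ) : κ * meanInfluence n θ t ≤ ν / 2 := by
  have hp := peak_pos n
  rw [couplingThreshold_eq, lt_div_iff₀ (by positivity)] at hκν
  have := mul_le_mul_of_nonneg_left (meanInfluence_le_peak hN n θ t) hκ.le
  linarith

lemma IsGlobalSolution.midpoint_ge (h : IsGlobalSolution n κ freq θ)
    (hfreq : ∀ i, freq i = ν) (hN : 0 < N) (hκ : 0 < κ)
    (hκν : κ < couplingThreshold n ν) (a b : Fin N) {t : ℝ} (ht : 0 ≤ t) :
    midpoint θ a b 0 + ν / 2 * t ≤ midpoint θ a b t := by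
  have := le_of_hasDerivWithinAt_nonneg (f := fun s => midpoint θ a b s - ν / 2 * s) ht
    (fun s hs => (h.hasDerivWithinAt_midpoint hfreq a b hs.1).sub
      ((hasDerivWithinAt_id s _).const_mul (ν / 2))) (fun s hs => by
      have h1 := mul_meanInfluence_le_half (θ := θ) hN hκ hκν s
      have h2 : 0 ≤ κ * meanInfluence n θ s := mul_nonneg hκ.le (meanInfluence_nonneg n θ s)
      have h3 : Real.cos (halfGap θ a b s) * Real.sin (midpoint θ a b s) ≤ 1 := by
        refine (le_abs_self _).trans ?_
        rw [abs_mul]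
        exact mul_le_one₀ (Real.abs_cos_le_one _) (abs_nonneg _) (Real.abs_sin_le_one _)
      nlinarith)
  simp at this
  linarith

lemma abs_meanInfluence_sub_midpoint_le (hn : 1 ≤ n) (hN : 0 < N) {a b : Fin N} {t : ℝ}
    (hab : ∀ j, θ a t ≤ θ j t ∧ θ j t ≤ θ b t) {α : ℝ} (hα : halfGap θ a b t ≤ α) :
    |meanInfluence n θ t - influence n (midpoint θ a b t)| ≤ influenceLip n * α := by
  refine abs_meanInfluence_sub_le hN n θ t _ _ fun j => ?_
  refine (abs_influence_sub_le hn _ _).trans ?_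
  have := (influenceLip_pos hn).le
  gcongr
  refine le_trans ?_ hα
  unfold midpoint halfGap
  rw [abs_le]
  constructor <;> linarith [(hab j).1, (hab j).2]

/-- As long as the half-gap of the extremal oscillators stays below `α`, it is controlled by the
integral of the net growth rate over the phases run through by the midpoint. -/
lemma IsGlobalSolution.halfGap_le_of_forall_le (h : IsGlobalSolution n κ freq θ)
    (hfreq : ∀ i, freq i = ν) (hn : 1 ≤ n) (hN : 0 < N) (hν : 0 < ν) (hκ : 0 < κ)
    (hκν : κ < couplingThreshold n ν) {a b : Fin N}
    (hab : ∀ t, 0 ≤ t → ∀ j, θ a t ≤ θ j t ∧ θ j t ≤ θ b t) {α : ℝ} (hα1 : α ≤ 1)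
    {T : ℝ} (hT : 0 ≤ T) (hle : ∀ t ∈ Icc 0 T, halfGap θ a b t ≤ α) :
    halfGap θ a b T ≤ Real.exp (κ / ν * ∫ x in (midpoint θ a b 0)..(midpoint θ a b T),
      (growthRate n (influenceLip n * α) x - decayRate n (influenceLip n * α) x)) *
        halfGap θ a b 0 := by
  set f : ℝ → ℝ := fun x =>
    growthRate n (influenceLip n * α) x - decayRate n (influenceLip n * α) x
  have hfc : Continuous f := (continuous_growthRate n _).sub (continuous_decayRate n _)
  set H : ℝ → ℝ := fun x => ∫ y in (midpoint θ a b 0)..x, f y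
  have hHd : ∀ x, HasDerivAt H (f x) x := fun x =>
    (hfc.integral_hasStrictDerivAt (midpoint θ a b 0) x).hasDerivAt
  -- Grönwall's argument with the phase as time: the integrating factor is a function of the
  -- midpoint alone.
  have key := le_of_hasDerivWithinAt_nonpos
    (f := fun t => halfGap θ a b t * Real.exp (-(κ / ν * H (midpoint θ a b t)))) hT
    (fun t ht => (h.hasDerivWithinAt_halfGap hfreq a b ht.1).mul
      ((((hHd (midpoint θ a b t)).comp_hasDerivWithinAt t
        (h.hasDerivWithinAt_midpoint hfreq a b ht.1)).const_mul (κ / ν)).neg.exp))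
    (fun t ht => by
      have h1 := neg_mul_cos_mul_sin_le hν hκ (meanInfluence_nonneg n θ t)
        (mul_meanInfluence_le_half hN hκ hκν t)
        (abs_meanInfluence_sub_midpoint_le hn hN (hab t ht.1) (hle t ht))
        (r := halfGap θ a b t)
        (by unfold halfGap; linarith [(hab t ht.1 b).1]) ((hle t ht).trans hα1)
      have h2 := mul_nonneg (sub_nonneg.2 h1)
        (Real.exp_pos (-(κ / ν * H (midpoint θ a b t)))).le
      have : f (midpoint θ a b t) = growthRate n (influenceLip n * α) (midpoint θ a b t) -
        decayRate n (influenceLip n * α) (midpoint θ a b t) := rfl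
      simp only [this, Pi.neg_apply, Function.comp_apply]
      linarith)
  have h0 : H (midpoint θ a b 0) = 0 := intervalIntegral.integral_same
  simp only [h0, mul_zero, neg_zero, Real.exp_zero, mul_one] at key
  rw [Real.exp_neg, ← div_eq_mul_inv, div_le_iff₀ (Real.exp_pos _), mul_comm] at key
  exact key

/-- This is where the exponent in `initialBound` comes from. -/
lemma mul_four_mul_le {α : ℝ} (hn : 1 ≤ n) (hν : 0 < ν) (hα : 0 < α)
    (hκν : κ < couplingThreshold n ν) :
    κ / ν * (4 * (coeff n + influenceLip n * α)) ≤ α * slope n + 1 / 2 ^ (n - 1) := by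
  have hp := peak_pos n
  have hL := influenceLip_pos hn
  have hc := coeff_pos n
  have h1 : κ / ν ≤ 1 / (2 * peak n) := by
    rw [couplingThreshold_eq] at hκν
    rw [div_le_iff₀ hν]
    refine hκν.le.trans (le_of_eq ?_)
    ring
  calc κ / ν * (4 * (coeff n + influenceLip n * α))
      ≤ 1 / (2 * peak n) * (4 * (coeff n + influenceLip n * α)) := by gcongr
    _ = α * slope n + 1 / 2 ^ (n - 1) := by
        obtain ⟨m, rfl⟩ : ∃ m, n = m + 1 := ⟨n - 1, by omega⟩
        have : 2 * coeff (m + 1) / peak (m + 1) = 1 / 2 ^ m := by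
          unfold peak
          rw [pow_succ]
          field_simp
        rw [Nat.add_sub_cancel, ← this]
        unfold influenceLip
        field_simp
        ring

lemma initialBound_eq (n : ℕ) (α : ℝ) :
    initialBound n α = α * Real.exp (-(α * slope n + 1 / 2 ^ (n - 1))) := by
  unfold initialBound slope
  ring_nf

lemma IsGlobalSolution.exists_rate (h : IsGlobalSolution n κ freq θ)
    (hfreq : ∀ i, freq i = ν) (hn : 2 ≤ n) (hN : 0 < N) (hν : 0 < ν) (hκ : 0 < κ)
    (hκν : κ < couplingThreshold n ν) {a b : Fin N}
    (hab : ∀ t, 0 ≤ t → ∀ j, θ a t ≤ θ j t ∧ θ j t ≤ θ b t) {α : ℝ} (hα : 0 < α)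
    (hαn : α < alphaThreshold n) :
    ∃ Λ : ℝ, 0 < Λ ∧ ∀ T, 0 ≤ T → (∀ t ∈ Icc 0 T, halfGap θ a b t ≤ α) →
      halfGap θ a b T ≤ Real.exp (α * slope n + 1 / 2 ^ (n - 1)) * Real.exp (-Λ * T) *
        halfGap θ a b 0 := by
  have hn1 : 1 ≤ n := by omega
  have hpi := Real.pi_pos
  set δ := influenceLip n * α with hδ
  have hδ0 : 0 < δ := mul_pos (influenceLip_pos hn1) hα
  have hc := coeff_pos n
  have hlt := influenceLip_mul_lt hn1 hαn
  rw [← hδ] at hlt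
  -- The first entry is the guaranteed loss per turn; the second caps `μ` so that `5/2 (coeff n + δ)
  -- + μ` stays within `4 (coeff n + δ)`.
  set μ := min (π * (n / (n + 1)) - (3 / 2 * coeff n + 7 / 2 * δ)) (3 / 2 * (coeff n + δ))
  have hμ0 : 0 < μ := lt_min (by linarith) (by linarith)
  -- The loss `κ μ / ν` per turn of `2π`, run through at speed at least `ν / 2`.
  refine ⟨κ * μ / (4 * π), by positivity, fun T hT hle => ?_⟩
  refine (h.halfGap_le_of_forall_le hfreq hn1 hN hν hκ hκν hab
    (lt_one_of_lt_alphaThreshold hn hαn).le hT hle).trans ?_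
  have hr0 : 0 ≤ halfGap θ a b 0 := by unfold halfGap; linarith [(hab 0 le_rfl b).1]
  rw [← Real.exp_add]
  gcongr
  have hmid := h.midpoint_ge hfreq hN hκ hκν a b hT
  have hνT : 0 ≤ ν / 2 * T := by positivity
  have hint := integral_periodic_le (T := 2 * π) (μ := μ) (by positivity) hμ0.le
    ((continuous_growthRate n δ).sub (continuous_decayRate n δ)) (continuous_growthRate n δ)
    ((growthRate_periodic n δ).sub (decayRate_periodic n δ)) (growthRate_periodic n δ)
    (fun x => sub_le_self _ (decayRate_nonneg n δ x)) (growthRate_nonneg hδ0.le)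
    ((integral_growthRate_sub_decayRate_le n).trans (by
      have : μ ≤ π * (n / (n + 1)) - (3 / 2 * coeff n + 7 / 2 * δ) := min_le_left _ _
      linarith))
    (show midpoint θ a b 0 ≤ midpoint θ a b T by linarith)
  have h1 : μ / (2 * π) * (ν / 2 * T) ≤ μ / (2 * π) * (midpoint θ a b T - midpoint θ a b 0) := by
    gcongr
    linarith
  have h2 : (∫ x in (0 : ℝ)..2 * π, growthRate n δ x) + μ ≤ 4 * (coeff n + δ) := by
    have h3 : μ ≤ 3 / 2 * (coeff n + δ) := min_le_right _ _
    have h4 := integral_growthRate_le n (δ := δ)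
    linarith
  have h5 := mul_four_mul_le hn1 hν hα hκν
  rw [← hδ] at h5
  calc _ ≤ κ / ν * (4 * (coeff n + δ) - μ / (2 * π) * (ν / 2 * T)) := by
        gcongr
        exact hint.trans (by linarith)
    _ = κ / ν * (4 * (coeff n + δ)) + -(κ * μ / (4 * π)) * T := by
        field_simp
        ring
    _ ≤ _ := by linarith

/-- Continuity argument: by `exists_rate` and the initial bound, `≤ α` up to time `T` forces `< α`
at `T`, which contradicts a first time at which `α` is reached. -/
lemma IsGlobalSolution.halfGap_lt (h : IsGlobalSolution n κ freq θ)
    (hfreq : ∀ i, freq i = ν) (hn : 2 ≤ n) (hN : 0 < N) (hν : 0 < ν) (hκ : 0 < κ)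
    (hκν : κ < couplingThreshold n ν) {a b : Fin N}
    (hab : ∀ t, 0 ≤ t → ∀ j, θ a t ≤ θ j t ∧ θ j t ≤ θ b t) {α : ℝ} (hα : 0 < α)
    (hαn : α < alphaThreshold n) (h0 : halfGap θ a b 0 < initialBound n α) {t : ℝ} (ht : 0 ≤ t) :
    halfGap θ a b t < α := by
  obtain ⟨Λ, hΛ, hrate⟩ := h.exists_rate hfreq hn hN hν hκ hκν hab hα hαn
  have hs := slope_pos (show 1 ≤ n by omega)
  rw [initialBound_eq, Real.exp_neg, ← div_eq_mul_inv, lt_div_iff₀ (Real.exp_pos _)] at h0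
  have hr0 : 0 ≤ halfGap θ a b 0 := by unfold halfGap; linarith [(hab 0 le_rfl b).1]
  have himp : ∀ T, 0 ≤ T → (∀ t ∈ Icc 0 T, halfGap θ a b t ≤ α) → halfGap θ a b T < α := by
    intro T hT hle
    refine (hrate T hT hle).trans_lt (lt_of_le_of_lt ?_ h0)
    rw [mul_comm (halfGap θ a b 0)]
    gcongr
    refine mul_le_of_le_one_right (Real.exp_pos _).le (Real.exp_le_one_iff.2 ?_)
    nlinarith
  by_contra hcon
  push Not at hcon
  have hcont : ContinuousOn (halfGap θ a b) (Icc 0 t) :=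
    (((h.continuousOn b).sub (h.continuousOn a)).div_const 2).mono fun s hs => hs.1
  set S := Icc 0 t ∩ halfGap θ a b ⁻¹' Ici α
  have hSc : IsClosed S := hcont.preimage_isClosed_of_isClosed isClosed_Icc isClosed_Ici
  have hSne : S.Nonempty := ⟨t, ⟨ht, le_rfl⟩, hcon⟩
  have hSb : BddBelow S := ⟨0, fun s hs => hs.1.1⟩
  have hmem := hSc.csInf_mem hSne hSb
  have hbefore : ∀ s, 0 ≤ s → s < sInf S → halfGap θ a b s < α := fun s hs0 hs => by
    by_contra hc
    push Not at hc
    exact absurd (csInf_le hSb ⟨⟨hs0, hs.le.trans hmem.1.2⟩, hc⟩) (not_le.2 hs)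
  have hzero : halfGap θ a b 0 < α := himp 0 le_rfl fun s hs => by
    have : s = 0 := le_antisymm hs.2 hs.1
    rw [this]
    have h1 : 1 ≤ Real.exp (α * slope n + 1 / 2 ^ (n - 1)) := Real.one_le_exp (by positivity)
    nlinarith
  have hpos : 0 < sInf S := by
    refine lt_of_le_of_ne hmem.1.1 fun he => ?_
    have : α ≤ halfGap θ a b (sInf S) := hmem.2
    rw [← he] at this
    linarith
  have hat : halfGap θ a b (sInf S) ≤ α := by
    have hsub : Icc 0 (sInf S) ⊆ Icc 0 t := Icc_subset_Icc_right hmem.1.2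
    have hcl : closure (Ico 0 (sInf S)) = Icc 0 (sInf S) := closure_Ico hpos.ne
    have hmaps : MapsTo (halfGap θ a b) (closure (Ico 0 (sInf S))) (closure (Iic α)) :=
      MapsTo.closure_of_continuousOn (fun s hs => (hbefore s hs.1 hs.2).le)
        (by rw [hcl]; exact hcont.mono hsub)
    rw [hcl, isClosed_Iic.closure_eq] at hmaps
    exact hmaps (right_mem_Icc.2 hpos.le)
  have := himp (sInf S) hpos.le fun s hs => by
    rcases hs.2.lt_or_eq with h1 | h1
    · exact (hbefore s hs.1 h1).le
    · rw [h1]; exact hat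
  exact absurd hmem.2 (not_le.2 this)

lemma IsGlobalSolution.le_halfGap (h : IsGlobalSolution n κ freq θ)
    (hfreq : ∀ i, freq i = ν) (hN : 0 < N) (hκ : 0 < κ) {a b : Fin N}
    (hab : ∀ t, 0 ≤ t → θ a t ≤ θ b t) {t : ℝ} (ht : 0 ≤ t) :
    Real.exp (-(κ * peak n) * t) * halfGap θ a b 0 ≤ halfGap θ a b t := by
  have hp := peak_pos n
  have key := le_of_hasDerivWithinAt_nonneg
    (f := fun t => halfGap θ a b t * Real.exp (κ * peak n * t)) ht
    (fun s hs => (h.hasDerivWithinAt_halfGap hfreq a b hs.1).mul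
      (((hasDerivWithinAt_id s _).const_mul (κ * peak n)).exp))
    (fun s hs => by
      have hr : 0 ≤ halfGap θ a b s := by unfold halfGap; linarith [hab s hs.1]
      have h1 : |κ * meanInfluence n θ s * Real.cos (midpoint θ a b s) *
          Real.sin (halfGap θ a b s)| ≤ κ * peak n * 1 * halfGap θ a b s := by
        rw [abs_mul, abs_mul, abs_mul, abs_of_pos hκ, abs_of_nonneg (meanInfluence_nonneg n θ s)]
        gcongr
        · exact meanInfluence_le_peak hN n θ s
        · exact Real.abs_cos_le_one _
        · exact (Real.abs_sin_le_abs).trans_eq (abs_of_nonneg hr)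
      have h2 := (abs_le.1 h1).2
      have h3 := mul_nonneg (show 0 ≤ κ * peak n * 1 * halfGap θ a b s - κ * meanInfluence n θ s *
        Real.cos (midpoint θ a b s) * Real.sin (halfGap θ a b s) by linarith)
        (Real.exp_pos (κ * peak n * s)).le
      simp only [id]
      linarith)
  simp only [mul_zero, Real.exp_zero, mul_one] at key
  rw [neg_mul, Real.exp_neg, mul_comm, ← div_eq_mul_inv, div_le_iff₀ (Real.exp_pos _)]
  exact key

end Solution

end Winfree

/-! ### Rotation numbers and locking -/

namespace Winfree

/-- A phase driven by a positive periodic vector field with an exponentially decaying perturbation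
stays at bounded distance from a uniform rotation. -/
lemma exists_hasRotationNumber {f x x' : ℝ → ℝ} {T c C Λ : ℝ} (hT : 0 < T) (hf : Continuous f)
    (hfp : Function.Periodic f T) (hc : 0 < c) (hcf : ∀ y, c ≤ f y) (hΛ : 0 < Λ)
    (hx : ∀ t, 0 ≤ t → HasDerivWithinAt x (x' t) (Ici 0) t) (hx0 : ∀ t, 0 ≤ t → x 0 ≤ x t)
    (hxf : ∀ t, 0 ≤ t → |x' t - f (x t)| ≤ C * Real.exp (-Λ * t)) :
    ∃ ρ, HasRotationNumber x ρ := by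
  have hfpos : ∀ y, 0 < f y := fun y => hc.trans_le (hcf y)
  set p : ℝ → ℝ := fun y => (f y)⁻¹
  have hp : Continuous p := hf.inv₀ fun y => (hfpos y).ne'
  have hpp : Function.Periodic p T := fun y => by simp only [p, hfp y]
  obtain ⟨B, hB⟩ := exists_abs_integral_periodic_sub_le hT hp hpp
  set m := (∫ y in (0 : ℝ)..T, p y) / T
  have hm : 0 < m := div_pos (intervalIntegral.intervalIntegral_pos_of_pos
    (hp.intervalIntegrable _ _) (fun y => inv_pos.2 (hfpos y)) hT) hT
  -- The primitive of `1 / f` straightens the flow: `P (x t)` would equal `t` without the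
  -- perturbation.
  set P : ℝ → ℝ := fun y => ∫ s in (x 0)..y, p s
  have hP0 : P (x 0) = 0 := intervalIntegral.integral_same
  have hPd : ∀ y, HasDerivAt P (p y) y := fun y =>
    (hp.integral_hasStrictDerivAt (x 0) y).hasDerivAt
  have hz : ∀ t, 0 ≤ t → HasDerivWithinAt (fun t => P (x t) - t) (p (x t) * x' t - 1) (Ici 0) t :=
    fun t ht => ((hPd (x t)).comp_hasDerivWithinAt t (hx t ht)).sub (hasDerivWithinAt_id t _)
  set K := C / c
  have hzb : ∀ t, 0 ≤ t → |p (x t) * x' t - 1| ≤ K * Real.exp (-Λ * t) := fun t ht => by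
    have e : p (x t) * x' t - 1 = (x' t - f (x t)) / f (x t) := by
      have := (hfpos (x t)).ne'
      simp only [p]
      field_simp
    rw [e, abs_div, abs_of_pos (hfpos _), div_mul_eq_mul_div]
    exact div_le_div₀ ((abs_nonneg _).trans (hxf t ht)) (hxf t ht) hc (hcf _)
  have hK : 0 ≤ K := by
    have := (abs_nonneg _).trans (hzb 0 le_rfl)
    simpa using this
  have hE : ∀ t, HasDerivWithinAt (fun t => K / Λ * Real.exp (-Λ * t))
      (-(K * Real.exp (-Λ * t))) (Ici 0) t := fun t => by
    refine ((((hasDerivWithinAt_id t _).const_mul (-Λ)).exp).const_mul (K / Λ)).congr_deriv ?_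
    simp only [id]
    field_simp
  have hz1 : ∀ t, 0 ≤ t → |P (x t) - t| ≤ K / Λ := fun t ht => by
    have h1 := le_of_hasDerivWithinAt_nonpos ht (fun s hs => (hz s hs.1).add (hE s))
      fun s hs => by linarith [(abs_le.1 (hzb s hs.1)).2]
    have h2 := le_of_hasDerivWithinAt_nonneg ht (fun s hs => (hz s hs.1).sub (hE s))
      fun s hs => by linarith [(abs_le.1 (hzb s hs.1)).1]
    have h3 : 0 ≤ K / Λ * Real.exp (-Λ * t) := by positivity
    simp [hP0] at h1 h2 h3
    rw [abs_le]
    constructor <;> linarith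
  -- Up to bounded errors, `P (x t)` is both `t` and `m (x t - x 0)`, with `m` the mean of `1 / f`.
  refine ⟨1 / m, ?_⟩
  have hbound : ∀ t, 0 < t → ‖x t / t - 1 / m‖ ≤ ((B + K / Λ) / m + |x 0|) / t := fun t ht => by
    have h1 := hz1 t ht.le
    have h2 := hB (x 0) (x t) (hx0 t ht.le)
    have e : x t / t - 1 / m = ((-(P (x t) - m * (x t - x 0)) + (P (x t) - t)) / m + x 0) / t := by
      field_simp
      ring
    rw [e, Real.norm_eq_abs, abs_div, abs_of_pos ht]
    gcongr
    refine (abs_add_le _ _).trans ?_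
    gcongr
    rw [abs_div, abs_of_pos hm]
    gcongr
    refine (abs_add_le _ _).trans ?_
    rw [abs_neg]
    exact add_le_add h2 h1
  rw [HasRotationNumber, tendsto_iff_norm_sub_tendsto_zero]
  refine squeeze_zero' (Eventually.of_forall fun t => norm_nonneg _)
    ((eventually_gt_atTop 0).mono hbound) ?_
  exact tendsto_const_nhds.div_atTop tendsto_id

lemma HasRotationNumber.abs_sub_le {x : ℝ → ℝ} {ρ ν q : ℝ} (h : HasRotationNumber x ρ)
    (hx : ∀ t, 0 ≤ t → |x t - x 0 - ν * t| ≤ q * t) : |ρ - ν| ≤ q := by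
  have h1 : Tendsto (fun t => |x t / t - ν|) atTop (𝓝 |ρ - ν|) := (h.sub_const ν).abs
  have h2 : Tendsto (fun t => q + |x 0| / t) atTop (𝓝 (q + 0)) :=
    tendsto_const_nhds.add (tendsto_const_nhds.div_atTop tendsto_id)
  rw [add_zero] at h2
  refine le_of_tendsto_of_tendsto h1 h2 ((eventually_gt_atTop 0).mono fun t ht => ?_)
  have e : x t / t - ν = ((x t - x 0 - ν * t) + x 0) / t := by
    field_simp
    ring
  simp only [e, abs_div, abs_of_pos ht]
  rw [div_le_iff₀ ht, add_mul, div_mul_cancel₀ _ ht.ne']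
  exact (abs_add_le _ _).trans (add_le_add (hx t ht.le) le_rfl)

lemma HasRotationNumber.congr_of_bounded {x y : ℝ → ℝ} {ρ B : ℝ} (h : HasRotationNumber x ρ)
    (hB : ∀ t, 0 ≤ t → |y t - x t| ≤ B) : HasRotationNumber y ρ := by
  have h0 : Tendsto (fun t => (y t - x t) / t) atTop (𝓝 0) := by
    refine squeeze_zero_norm' ((eventually_gt_atTop 0).mono fun t ht => ?_)
      (tendsto_const_nhds.div_atTop tendsto_id : Tendsto (fun t : ℝ => B / t) atTop (𝓝 0))
    rw [Real.norm_eq_abs, abs_div, abs_of_pos ht]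
    exact div_le_div_of_nonneg_right (hB t ht.le) ht.le
  have := h.add h0
  rw [add_zero] at this
  refine this.congr fun t => ?_
  ring

section Solution

variable {N n : ℕ} {κ ν : ℝ} {freq : Fin N → ℝ} {θ : Fin N → ℝ → ℝ}

lemma IsGlobalSolution.abs_sub_sub_le (h : IsGlobalSolution n κ freq θ) (hfreq : ∀ i, freq i = ν)
    (hN : 0 < N) (hκ : 0 < κ) (i : Fin N) {t : ℝ} (ht : 0 ≤ t) :
    |θ i t - θ i 0 - ν * t| ≤ κ * peak n * t := by
  have hb : ∀ s, |κ * meanInfluence n θ s * Real.sin (θ i s)| ≤ κ * peak n := fun s => by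
    rw [abs_mul, abs_mul, abs_of_pos hκ, abs_of_nonneg (meanInfluence_nonneg n θ s)]
    have h1 := meanInfluence_le_peak hN n θ s
    have h2 : 0 ≤ κ * meanInfluence n θ s := mul_nonneg hκ.le (meanInfluence_nonneg n θ s)
    exact (mul_le_of_le_one_right h2 (Real.abs_sin_le_one _)).trans (by gcongr)
  have h1 := le_of_hasDerivWithinAt_nonpos (f := fun s => θ i s - (ν + κ * peak n) * s) ht
    (fun s hs => (h.hasDerivWithinAt hfreq i hs.1).sub
      ((hasDerivWithinAt_id s _).const_mul (ν + κ * peak n)))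
    fun s _ => by linarith [(abs_le.1 (hb s)).1]
  have h2 := le_of_hasDerivWithinAt_nonneg (f := fun s => θ i s - (ν - κ * peak n) * s) ht
    (fun s hs => (h.hasDerivWithinAt hfreq i hs.1).sub
      ((hasDerivWithinAt_id s _).const_mul (ν - κ * peak n)))
    fun s _ => by linarith [(abs_le.1 (hb s)).2]
  rw [abs_le]
  constructor <;> linarith

/-- The lowest phase obeys the scalar equation up to an exponentially small error, and the others
stay at bounded distance from it. The rotation number is positive because `κ * peak n < ν / 2`. -/
lemma IsGlobalSolution.exists_exhibitsLocking (h : IsGlobalSolution n κ freq θ)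
    (hfreq : ∀ i, freq i = ν) (hn : 1 ≤ n) (hN : 0 < N) (hν : 0 < ν) (hκ : 0 < κ)
    (hκν : κ < couplingThreshold n ν) {a b : Fin N}
    (hab : ∀ t, 0 ≤ t → ∀ j, θ a t ≤ θ j t ∧ θ j t ≤ θ b t) {C Λ : ℝ} (hC : 0 ≤ C) (hΛ : 0 < Λ)
    (hdecay : ∀ t, 0 ≤ t → halfGap θ a b t ≤ C * Real.exp (-Λ * t)) :
    ∃ ρ, ExhibitsLocking θ ρ ∧ |ρ - ν| ≤ κ * peak n := by
  have hp := peak_pos n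
  have hL := influenceLip_pos hn
  have hI := continuous_influence n
  have hκp : κ * peak n < ν / 2 := by
    rw [couplingThreshold_eq, lt_div_iff₀ (by positivity)] at hκν
    linarith
  obtain ⟨ρ, hρ⟩ := exists_hasRotationNumber (f := fun y => ν - κ * influence n y * Real.sin y)
    (c := ν / 2) (C := κ * (influenceLip n * (2 * C))) (x := θ a) Real.two_pi_pos (by fun_prop)
    (fun y => by simp [influence_periodic n y]) (by positivity)
    (fun y => by
      have h1 : κ * influence n y * Real.sin y ≤ κ * influence n y :=
        mul_le_of_le_one_right (mul_nonneg hκ.le (influence_nonneg n y)) (Real.sin_le_one y)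
      have h2 : κ * influence n y ≤ κ * peak n := by
        have := influence_le_peak n y
        gcongr
      linarith) hΛ (fun t ht => h.hasDerivWithinAt hfreq a ht)
    (fun t ht => by
      have h1 := (abs_le.1 (h.abs_sub_sub_le hfreq hN hκ a ht)).1
      nlinarith)
    (fun t ht => by
      have e : ν - κ * meanInfluence n θ t * Real.sin (θ a t) -
          (ν - κ * influence n (θ a t) * Real.sin (θ a t))
          = -(κ * (meanInfluence n θ t - influence n (θ a t)) * Real.sin (θ a t)) := by ring
      rw [e, abs_neg, abs_mul, abs_mul, abs_of_pos hκ]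
      have h1 : |meanInfluence n θ t - influence n (θ a t)| ≤
          influenceLip n * (2 * (C * Real.exp (-Λ * t))) := by
        refine abs_meanInfluence_sub_le hN n θ t _ _ fun j => ?_
        refine (abs_influence_sub_le hn _ _).trans ?_
        gcongr
        have h2 := hdecay t ht
        unfold halfGap at h2
        rw [abs_of_nonneg (sub_nonneg.2 (hab t ht j).1)]
        linarith [(hab t ht j).2]
      calc κ * |meanInfluence n θ t - influence n (θ a t)| * |Real.sin (θ a t)|
          ≤ κ * |meanInfluence n θ t - influence n (θ a t)| :=
            mul_le_of_le_one_right (by positivity) (Real.abs_sin_le_one _)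
        _ ≤ κ * (influenceLip n * (2 * (C * Real.exp (-Λ * t)))) := by gcongr
        _ = _ := by ring)
  have hρν := hρ.abs_sub_le fun t ht => h.abs_sub_sub_le hfreq hN hκ a ht
  refine ⟨ρ, ⟨?_, fun i => ?_⟩, hρν⟩
  · have := (abs_le.1 hρν).1
    exact (show 0 < ρ by linarith).ne'
  · refine hρ.congr_of_bounded (B := 2 * C) fun t ht => ?_
    rw [abs_of_nonneg (sub_nonneg.2 (hab t ht i).1)]
    have h1 := hdecay t ht
    have h2 : C * Real.exp (-Λ * t) ≤ C :=
      mul_le_of_le_one_right hC (Real.exp_le_one_iff.2 (by nlinarith))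
    unfold halfGap at h1
    linarith [(hab t ht i).2]

end Solution

end Winfree

theorem theorem5p1 :
    -- the two thresholds have the stated orders in `n`
    (∀ ν : ℝ, 0 < ν →
      (fun n : ℕ => Winfree.couplingThreshold n ν) =Θ[atTop] (fun n : ℕ => ν / √(n : ℝ))) ∧
    (fun n : ℕ => Winfree.alphaThreshold n) =Θ[atTop] (fun n : ℕ => 1 / (n : ℝ)) ∧
    -- exponential decay of the half-diameter, and locking
    (∀ (n N : ℕ) (κ ν α : ℝ) (freq : Fin N → ℝ) (θ : Fin N → ℝ → ℝ),
      2 ≤ n → 0 < N → 0 < ν → (∀ i, freq i = ν) →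
      0 < κ → κ < Winfree.couplingThreshold n ν →
      0 < α → α < Winfree.alphaThreshold n →
      Winfree.IsGlobalSolution n κ freq θ →
      Winfree.halfDiameter θ 0 < Winfree.initialBound n α →
      (∃ β₁ β₂ Λ₁ Λ₂ : ℝ, 0 < β₁ ∧ 0 < β₂ ∧ 0 < Λ₁ ∧ 0 < Λ₂ ∧
        ∀ t : ℝ, 0 ≤ t →
          β₁ * Real.exp (-Λ₁ * t) * Winfree.halfDiameter θ 0 ≤ Winfree.halfDiameter θ t ∧
          Winfree.halfDiameter θ t ≤ β₂ * Real.exp (-Λ₂ * t) * Winfree.halfDiameter θ 0 ∧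
          β₂ * Real.exp (-Λ₂ * t) * Winfree.halfDiameter θ 0 < α) ∧
      (∃ ρ : ℝ, Winfree.ExhibitsLocking θ ρ ∧ |ρ - ν| ≤ κ * (2 ^ n * Winfree.coeff n))) := by
  refine ⟨fun ν hν => Winfree.couplingThreshold_isTheta hν, Winfree.alphaThreshold_isTheta, ?_⟩
  intro n N κ ν α freq θ hn hN hν hfreq hκ hκν hα hαn h h0
  obtain ⟨a, b, hext⟩ := h.exists_extremal hfreq hN
  have hab := fun t ht => (hext t ht).1
  have hgap : ∀ t, 0 ≤ t → Winfree.halfDiameter θ t = Winfree.halfGap θ a b t :=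
    fun t ht => (hext t ht).2
  rw [hgap 0 le_rfl] at h0 ⊢
  have hr0 : 0 ≤ Winfree.halfGap θ a b 0 := by
    unfold Winfree.halfGap; linarith [(hab 0 le_rfl b).1]
  obtain ⟨Λ, hΛ, hrate⟩ := h.exists_rate hfreq hn hN hν hκ hκν hab hα hαn
  -- With this `β`, `initialBound n α` equals `α / β`, which gives the strict bound by `α`.
  set β := Real.exp (α * Winfree.slope n + 1 / 2 ^ (n - 1))
  have hβ : 0 < β := Real.exp_pos _
  have hdecay : ∀ t, 0 ≤ t →
      Winfree.halfGap θ a b t ≤ β * Real.exp (-Λ * t) * Winfree.halfGap θ a b 0 := fun t ht =>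
    hrate t ht fun s hs => (h.halfGap_lt hfreq hn hN hν hκ hκν hab hα hαn h0 hs.1).le
  refine ⟨⟨1, β, κ * Winfree.peak n, Λ, one_pos, hβ, mul_pos hκ (Winfree.peak_pos n), hΛ,
    fun t ht => ?_⟩, ?_⟩
  · rw [hgap t ht, one_mul]
    refine ⟨h.le_halfGap hfreq hN hκ (fun s hs => (hab s hs b).1) ht, hdecay t ht, ?_⟩
    rw [Winfree.initialBound_eq, Real.exp_neg, ← div_eq_mul_inv, lt_div_iff₀ hβ] at h0
    refine lt_of_le_of_lt ?_ h0
    rw [mul_comm (Winfree.halfGap θ a b 0)]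
    gcongr
    exact mul_le_of_le_one_right hβ.le (Real.exp_le_one_iff.2 (by nlinarith))
  · exact h.exists_exhibitsLocking hfreq (by omega) hN hν hκ hκν hab
      (mul_nonneg hβ.le hr0) hΛ fun t ht => (hdecay t ht).trans_eq (by ring)
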